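/- Let $E,F\subset\mathbb C$ be the fractal squares with contraction ratio $1/3$ and digit sets $$\mathcal D_E=\{0,1,2,2+i,1+2i\},\qquad \mathcal D_F=\{1+2i,1+i,1,0,2+i\},$$ that is, $E$ and $F$ are the unique nonempty compact sets satisfying $E=\tfrac13(E+\mathcal D_E)$ and $F=\tfrac13(F+\mathcal D_F)$. Both belong to the class $\mathcal F_{3,5}$ of fractal squares with contraction ratio $1/3$ and five digits in $\{0,1,2\}+\{0,1,2\}i$, and each of $E$ and $F$ is neither connected nor totally disconnected. Let $s=\log 5/\log 3$. Then $\dim_H E=\dim_H F=s$, the $s$-dimensional Hausdorff measures $\mathcal H^s(E)$ and $\mathcal H^s(F)$ are positive and finite, and there exists a bi-Lipschitz bijection $f:E\to F$, i.e. a bijection for which there is a constant $C>0$ with $$C^{-1}|x-y|\le |f(x)-f(y)|\le C|x-y|\qquad (x,y\in E),$$ that is measure-preserving in the following sense: for every Borel set $B\subset E$, $$\mathcal H^s(B)=\frac{\mathcal H^s(E)}{\mathcal H^s(F)}\,\mathcal H^s(f(B)),$$ so that $\mathcal H^s(B)/\mathcal H^s(f(B))=\mathcal H^s(E)/\mathcal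 H^s(F)$ whenever $\mathcal H^s(B)\neq 0$. -/

import Mathlib

open Set MeasureTheory
open scoped NNReal ENNReal

/-- The digits available in base `n` in the plane: `{0, …, n-1} + {0, …, n-1} i`. -/
def digitGrid (n : ℕ) : Set ℂ :=
  {z | ∃ a b : ℕ, a < n ∧ b < n ∧ z = (a : ℂ) + (b : ℂ) * Complex.I}

/-- `K` is the attractor of the iterated function system `φ`: a nonempty compact set with
`K = ⋃ j, φ j (K)`. -/
structure IsAttractor {ι : Type*} (φ : ι → ℂ → ℂ) (K : Set ℂ) : Prop where
  nonempty : K.Nonempty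
  isCompact : IsCompact K
  eq_iUnion : K = ⋃ j, φ j '' K

/-- `K` is the fractal square of contraction ratio `1 / n` with digit set `D`: the attractor of the
maps `x ↦ (x + d) / n`, `d ∈ D`. -/
structure IsFractalSquare (n : ℕ) (D : Set ℂ) (K : Set ℂ) : Prop where
  two_le : 2 ≤ n
  digits : D ⊆ digitGrid n
  isAttractor : IsAttractor (fun (d : D) (x : ℂ) => (x + (d : ℂ)) / (n : ℂ)) K

/-- The class `𝓕_{n,m}` of fractal squares with contraction ratio `1 / n` and `m` digits. -/
def fractalSquareClass (n m : ℕ) : Set (Set ℂ) :=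
  {K | ∃ D : Set ℂ, D.ncard = m ∧ IsFractalSquare n D K}

/-- The digit set of `E`. -/
def digitsE : Set ℂ := {0, 1, 2, 2 + Complex.I, 1 + 2 * Complex.I}

/-- The digit set of `F`. -/
def digitsF : Set ℂ := {1 + 2 * Complex.I, 1 + Complex.I, 1, 0, 2 + Complex.I}

/-- `f` restricts to a bi-Lipschitz bijection of `A` onto `B`. -/
def IsBiLipschitzOn (f : ℂ → ℂ) (A B : Set ℂ) : Prop :=
  BijOn f A B ∧ ∃ C : ℝ, 0 < C ∧ ∀ x ∈ A, ∀ y ∈ A,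
    C⁻¹ * dist x y ≤ dist (f x) (f y) ∧ dist (f x) (f y) ≤ C * dist x y

theorem digitGrid_finite (n : ℕ) : (digitGrid n).Finite := by
  refine (((finite_lt_nat n).prod (finite_lt_nat n)).image
    (fun p : ℕ × ℕ => (p.1 : ℂ) + (p.2 : ℂ) * Complex.I)).subset ?_
  rintro z ⟨a, b, ha, hb, rfl⟩
  exact ⟨(a, b), ⟨ha, hb⟩, rfl⟩

/-- A nonempty set of digits determines exactly one fractal square. -/
theorem existsUnique_isFractalSquare {n : ℕ} (hn : 2 ≤ n) {D : Set ℂ} (hD : D ⊆ digitGrid n)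
    (hne : D.Nonempty) : ∃! K : Set ℂ, IsFractalSquare n D K := by
  have hfin : Finite D := ((digitGrid_finite n).subset hD).to_subtype
  have hneD : Nonempty D := hne.to_subtype
  set φ : D → ℂ → ℂ := fun d x => (x + (d : ℂ)) / (n : ℂ) with hφ
  have hcont : ∀ d, Continuous (φ d) := fun d => by simp only [hφ]; fun_prop
  have hn0 : (n : ℝ≥0) ≠ 0 := by exact_mod_cast (by omega : n ≠ 0)
  let T : TopologicalSpace.NonemptyCompacts ℂ → TopologicalSpace.NonemptyCompacts ℂ := fun K =>
    ⟨⟨⋃ d, φ d '' (K : Set ℂ), isCompact_iUnion fun d => K.isCompact.image (hcont d)⟩, by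
      obtain ⟨d⟩ := hneD
      obtain ⟨x, hx⟩ := K.nonempty
      exact ⟨φ d x, mem_iUnion.2 ⟨d, x, hx, rfl⟩⟩⟩
  have hTcoe : ∀ K, (T K : Set ℂ) = ⋃ d, φ d '' (K : Set ℂ) := fun K => rfl
  have hedist : ∀ d x y, edist (φ d x) (φ d y) = ((n : ℝ≥0)⁻¹ : ℝ≥0) * edist x y := by
    intro d x y
    rw [edist_nndist, edist_nndist, ← ENNReal.coe_mul]
    congr 1
    ext
    simp only [coe_nndist, NNReal.coe_mul, NNReal.coe_inv, NNReal.coe_natCast, dist_eq_norm, hφ]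
    rw [← sub_div, add_sub_add_right_eq_sub, norm_div, Complex.norm_natCast]
    ring
  have key : ∀ K L : TopologicalSpace.NonemptyCompacts ℂ, ∀ x ∈ (T K : Set ℂ),
      ∃ y ∈ (T L : Set ℂ), edist x y ≤
        ((n : ℝ≥0)⁻¹ : ℝ≥0) * Metric.hausdorffEDist (K : Set ℂ) (L : Set ℂ) := by
    intro K L x hx
    rw [hTcoe] at hx
    obtain ⟨d, a, ha, rfl⟩ := mem_iUnion.1 hx
    obtain ⟨b, hb, hab⟩ := L.isCompact.exists_infEDist_eq_edist L.nonempty a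
    refine ⟨φ d b, mem_iUnion.2 ⟨d, b, hb, rfl⟩, ?_⟩
    rw [hedist, ← hab]
    gcongr
    exact Metric.infEDist_le_hausdorffEDist_of_mem ha
  have hT : ContractingWith ((n : ℝ≥0)⁻¹) T := by
    refine ⟨inv_lt_one_of_one_lt₀ (by exact_mod_cast (by omega : 1 < n)), fun K L => ?_⟩
    refine Metric.hausdorffEDist_le_of_mem_edist (key K L) fun x hx => ?_
    obtain ⟨y, hy, h⟩ := key L K x hx
    refine ⟨y, hy, h.trans_eq ?_⟩
    rw [Metric.hausdorffEDist_comm]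
    rfl
  have : Nonempty (TopologicalSpace.NonemptyCompacts ℂ) := ⟨{0}⟩
  refine ⟨((ContractingWith.fixedPoint T hT : TopologicalSpace.NonemptyCompacts ℂ) : Set ℂ),
    ⟨hn, hD, ?_⟩, ?_⟩
  · refine ⟨TopologicalSpace.NonemptyCompacts.nonempty _,
      TopologicalSpace.NonemptyCompacts.isCompact _, ?_⟩
    exact congrArg (fun K : TopologicalSpace.NonemptyCompacts ℂ => (K : Set ℂ))
      hT.fixedPoint_isFixedPt.symm
  · rintro K ⟨-, -, hK⟩
    let K' : TopologicalSpace.NonemptyCompacts ℂ := ⟨⟨K, hK.isCompact⟩, hK.nonempty⟩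
    have hfix : Function.IsFixedPt T K' := SetLike.coe_injective hK.eq_iUnion.symm
    exact congrArg (fun K : TopologicalSpace.NonemptyCompacts ℂ => (K : Set ℂ))
      (hT.fixedPoint_unique hfix)

theorem digitsE_subset : digitsE ⊆ digitGrid 3 := by
  rintro z (rfl | rfl | rfl | rfl | rfl)
  · exact ⟨0, 0, by norm_num, by norm_num, by simp⟩
  · exact ⟨1, 0, by norm_num, by norm_num, by simp⟩
  · exact ⟨2, 0, by norm_num, by norm_num, by simp⟩
  · exact ⟨2, 1, by norm_num, by norm_num, by simp⟩
  · exact ⟨1, 2, by norm_num, by norm_num, by simp⟩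

theorem digitsF_subset : digitsF ⊆ digitGrid 3 := by
  rintro z (rfl | rfl | rfl | rfl | rfl)
  · exact ⟨1, 2, by norm_num, by norm_num, by simp⟩
  · exact ⟨1, 1, by norm_num, by norm_num, by simp⟩
  · exact ⟨1, 0, by norm_num, by norm_num, by simp⟩
  · exact ⟨0, 0, by norm_num, by norm_num, by simp⟩
  · exact ⟨2, 1, by norm_num, by norm_num, by simp⟩

/-- The fractal squares `E` and `F` exist and are unique. -/
theorem existsUnique_E_and_F :
    (∃! E : Set ℂ, IsFractalSquare 3 digitsE E) ∧ ∃! F : Set ℂ, IsFractalSquare 3 digitsF F :=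
  ⟨existsUnique_isFractalSquare (by norm_num) digitsE_subset ⟨0, by simp [digitsE]⟩,
    existsUnique_isFractalSquare (by norm_num) digitsF_subset ⟨0, by simp [digitsF]⟩⟩

/-! Both sets are coded by infinite words over five letters so that the distance of two points is
determined up to constants by the words alone; the map "same code" is then bi-Lipschitz. In a chain
(`IsChain`) the letters 0, 1, 2 give pieces touching end to end along [0,1], and all other pairs of
pieces are uniformly apart. Level-n cylinders then touch only in the pattern `Near`, and |Ψ x - Ψ y|
is comparable to 3^(-n) at the last level n where the cylinders are near (`norm_sub_le_of_near`,
`le_norm_sub_of_not_near`).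

F, rotated by a quarter turn, is such a chain. E is not: the tip 1/2 + i of the piece with digit 2
meets the bottom of the piece with digit 2 + i. The remedy is to cut E differently. With K the
corner piece and KK its corner piece, the two pieces exchange their KK parts, which leaves their
union unchanged but separates them. The lowered KK now touches the bottom of a middle piece, so the
exchange is repeated there at a smaller scale. The process closes up with five shapes, a
finite-state transducer: `eq_tile_E` says that it still produces E, and `transducerE.separated` that
the contacts are gone.

For the measure, subadditivity makes the Hausdorff measures of the shapes subharmonic on the state
graph, hence equal by the maximum principle. So every level-n cylinder carries the fraction 5^(-n)
of the measure, in E as in F (`isUniform`). Corresponding closed sets have the same codes, hence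
proportional measures, and a π-system argument extends this to Borel sets. Positivity and finiteness
come from the mass distribution principle and from covering by cylinders. -/

/-! ### Words and graph-directed systems in base 3. -/

/-- Prepend a letter to an infinite word. -/
def consWord (t : Fin 5) (x : ℕ → Fin 5) : ℕ → Fin 5
  | 0 => t
  | n + 1 => x n

/-- Delete the first letter of an infinite word. -/
def tailWord (x : ℕ → Fin 5) : ℕ → Fin 5 := fun n => x (n + 1)

@[simp] theorem consWord_zero (t : Fin 5) (x : ℕ → Fin 5) : consWord t x 0 = t := rfl

@[simp] theorem tailWord_consWord (t : Fin 5) (x : ℕ → Fin 5) : tailWord (consWord t x) = x := rfl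

theorem mem_of_forall_dist_le {X : Type*} [PseudoMetricSpace X] {S : Set X} (hS : IsClosed S)
    {z : X} {R : ℝ} (h : ∀ n : ℕ, ∃ w ∈ S, dist z w ≤ R * (1 / 3) ^ n) : z ∈ S := by
  refine hS.closure_subset (Metric.mem_closure_iff.2 fun ε hε => ?_)
  have hlim : Filter.Tendsto (fun n : ℕ => R * (1 / 3 : ℝ) ^ n) Filter.atTop (nhds 0) := by
    simpa using (tendsto_pow_atTop_nhds_zero_of_lt_one (by norm_num : (0 : ℝ) ≤ 1 / 3)
      (by norm_num)).const_mul R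
  obtain ⟨n, hn⟩ := (hlim.eventually (gt_mem_nhds hε)).exists
  obtain ⟨w, hw, hzw⟩ := h n
  exact ⟨w, hw, hzw.trans_lt hn⟩

/-- A transducer that reads words over five letters and writes digits in base `3`. -/
structure DigitTransducer (Q : Type*) where
  /-- the transition function -/
  next : Q → Fin 5 → Q
  /-- the digit written -/
  digit : Q → Fin 5 → ℂ

namespace DigitTransducer

variable {Q : Type*} (A : DigitTransducer Q)

/-- The state after reading the first `n` letters. -/
def state (q : Q) (x : ℕ → Fin 5) : ℕ → Q
  | 0 => q
  | n + 1 => A.next (state q x n) (x n)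

/-- The point whose base `3` expansion is the output on input `x`, started in state `q`. -/
noncomputable def point (q : Q) (x : ℕ → Fin 5) : ℂ :=
  ∑' k, A.digit (A.state q x k) (x k) / 3 ^ (k + 1)

/-- All points produced from the state `q`. -/
def tile (q : Q) : Set ℂ := range (A.point q)

theorem point_mem_tile (q : Q) (x : ℕ → Fin 5) : A.point q x ∈ A.tile q := mem_range_self x

variable {A}

theorem state_succ (q : Q) (x : ℕ → Fin 5) (n : ℕ) :
    A.state q x (n + 1) = A.state (A.next q (x 0)) (tailWord x) n := by
  induction n with
  | zero => rfl
  | succ n ih => rw [state, ih]; rfl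

theorem norm_term_le {B : ℝ} (hB : ∀ q t, ‖A.digit q t‖ ≤ B) (q : Q) (x : ℕ → Fin 5) (k : ℕ) :
    ‖A.digit (A.state q x k) (x k) / 3 ^ (k + 1)‖ ≤ B / 3 * (1 / 3) ^ k := by
  rw [norm_div, norm_pow, Complex.norm_ofNat, pow_succ, div_pow, one_pow]
  calc _ ≤ B / (3 ^ k * 3) := by gcongr; exact hB _ _
    _ = _ := by field_simp

theorem summable_bound (B : ℝ) : Summable fun k : ℕ => B / 3 * (1 / 3 : ℝ) ^ k :=
  (summable_geometric_of_lt_one (by norm_num) (by norm_num)).mul_left _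

theorem summable_term {B : ℝ} (hB : ∀ q t, ‖A.digit q t‖ ≤ B) (q : Q) (x : ℕ → Fin 5) :
    Summable fun k => A.digit (A.state q x k) (x k) / (3 : ℂ) ^ (k + 1) :=
  (summable_bound B).of_norm_bounded (norm_term_le hB q x)

theorem point_eq {B : ℝ} (hB : ∀ q t, ‖A.digit q t‖ ≤ B) (q : Q) (x : ℕ → Fin 5) :
    A.point q x = (A.point (A.next q (x 0)) (tailWord x) + A.digit q (x 0)) / 3 := by
  rw [point, (summable_term hB q x).tsum_eq_zero_add, point, add_div, add_comm, ← tsum_div_const]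
  congr 1
  · refine tsum_congr fun k => ?_
    rw [state_succ, div_div, ← pow_succ]
    rfl
  · simp [state]

theorem norm_point_le {B : ℝ} (hB : ∀ q t, ‖A.digit q t‖ ≤ B) (q : Q) (x : ℕ → Fin 5) :
    ‖A.point q x‖ ≤ B / 2 := by
  refine (tsum_of_norm_bounded (summable_bound B).hasSum (norm_term_le hB q x)).trans_eq ?_
  rw [tsum_mul_left, tsum_geometric_of_lt_one (by norm_num) (by norm_num)]
  ring

theorem continuous_state [TopologicalSpace Q] [DiscreteTopology Q] (q : Q) (n : ℕ) :
    Continuous fun x => A.state q x n := by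
  induction n with
  | zero => exact continuous_const
  | succ n ih =>
    have : Continuous fun p : Q × Fin 5 => A.next p.1 p.2 := continuous_of_discreteTopology
    exact this.comp (ih.prodMk (continuous_apply n))

theorem continuous_point {B : ℝ} (hB : ∀ q t, ‖A.digit q t‖ ≤ B) (q : Q) :
    Continuous (A.point q) := by
  let _ : TopologicalSpace Q := ⊥
  have : DiscreteTopology Q := ⟨rfl⟩
  refine continuous_tsum (fun k => ?_) (summable_bound B) fun k x => norm_term_le hB q x k
  have : Continuous fun p : Q × Fin 5 => A.digit p.1 p.2 := continuous_of_discreteTopology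
  exact (this.comp ((continuous_state q k).prodMk (continuous_apply k))).div_const _

theorem isCompact_tile {B : ℝ} (hB : ∀ q t, ‖A.digit q t‖ ≤ B) (q : Q) : IsCompact (A.tile q) :=
  isCompact_range (continuous_point hB q)

theorem mem_tile_cases {B : ℝ} (hB : ∀ q t, ‖A.digit q t‖ ≤ B) {q : Q} {z : ℂ}
    (hz : z ∈ A.tile q) : ∃ t, ∃ w ∈ A.tile (A.next q t), z = (w + A.digit q t) / 3 := by
  obtain ⟨x, rfl⟩ := hz
  exact ⟨x 0, _, A.point_mem_tile _ _, point_eq hB q x⟩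

theorem mem_tile_of_mem_next {B : ℝ} (hB : ∀ q t, ‖A.digit q t‖ ≤ B) {q : Q} {t : Fin 5} {w : ℂ}
    (hw : w ∈ A.tile (A.next q t)) : (w + A.digit q t) / 3 ∈ A.tile q := by
  obtain ⟨x, rfl⟩ := hw
  exact ⟨consWord t x, by rw [point_eq hB, tailWord_consWord, consWord_zero]⟩

/-- One half of the uniqueness of the attractor of a graph-directed system: n backward steps
followed by n forward steps shrink an initial distance at most R + B/2 by 3^(-n), and tiles are
closed. -/
theorem subset_tile {B : ℝ} (hB : ∀ q t, ‖A.digit q t‖ ≤ B) {S : Q → Set ℂ} {R : ℝ}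
    (hR : ∀ q, ∀ z ∈ S q, ‖z‖ ≤ R)
    (hS : ∀ q, ∀ z ∈ S q, ∃ t, ∃ w ∈ S (A.next q t), z = (w + A.digit q t) / 3) (q : Q) :
    S q ⊆ A.tile q := by
  have key : ∀ n : ℕ, ∀ q, ∀ z ∈ S q, ∃ w ∈ A.tile q, dist z w ≤ (R + B / 2) * (1 / 3) ^ n := by
    intro n
    induction n with
    | zero =>
      intro q z hz
      refine ⟨_, A.point_mem_tile q fun _ => 0, ?_⟩
      rw [dist_eq_norm, pow_zero, mul_one]
      exact (norm_sub_le _ _).trans (add_le_add (hR q z hz) (norm_point_le hB _ _))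
    | succ n ih =>
      intro q z hz
      obtain ⟨t, w, hw, rfl⟩ := hS q z hz
      obtain ⟨u, hu, hwu⟩ := ih _ w hw
      refine ⟨_, mem_tile_of_mem_next hB hu, ?_⟩
      rw [dist_eq_norm, ← sub_div, add_sub_add_right_eq_sub, norm_div, Complex.norm_ofNat,
        ← dist_eq_norm, pow_succ]
      linarith
  exact fun z hz => mem_of_forall_dist_le (isCompact_tile hB q).isClosed fun n => key n q z hz

/-- The other half of uniqueness. It also confines tiles to explicit convex regions, since such a
region only has to be stable under the maps. -/
theorem tile_subset {B : ℝ} (hB : ∀ q t, ‖A.digit q t‖ ≤ B) {S : Q → Set ℂ} {R : ℝ}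
    (hR : ∀ q, ∃ z ∈ S q, ‖z‖ ≤ R) (hclosed : ∀ q, IsClosed (S q))
    (hS : ∀ q t, ∀ w ∈ S (A.next q t), (w + A.digit q t) / 3 ∈ S q) (q : Q) :
    A.tile q ⊆ S q := by
  have key : ∀ n : ℕ, ∀ q, ∀ z ∈ A.tile q, ∃ w ∈ S q, dist z w ≤ (R + B / 2) * (1 / 3) ^ n := by
    intro n
    induction n with
    | zero =>
      rintro q _ ⟨x, rfl⟩
      obtain ⟨w, hw, hwR⟩ := hR q
      refine ⟨w, hw, ?_⟩
      rw [dist_eq_norm, pow_zero, mul_one]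
      exact (norm_sub_le _ _).trans (by linarith [norm_point_le hB q x])
    | succ n ih =>
      intro q z hz
      obtain ⟨t, w, hw, rfl⟩ := mem_tile_cases hB hz
      obtain ⟨u, hu, hwu⟩ := ih _ w hw
      refine ⟨_, hS q t u hu, ?_⟩
      rw [dist_eq_norm, ← sub_div, add_sub_add_right_eq_sub, norm_div, Complex.norm_ofNat,
        ← dist_eq_norm, pow_succ]
      linarith
  exact fun z hz => mem_of_forall_dist_le (hclosed q) fun n => key n q z hz

end DigitTransducer

/-! ### Combinatorics of touching cylinders. -/

/-- The pieces with letters `i` and `j` touch at the right end of the former. -/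
def Adjacent (i j : Fin 5) : Prop := (i = 0 ∧ j = 1) ∨ (i = 1 ∧ j = 2)

/-- The first `n` letters agree. -/
def SamePrefix (n : ℕ) (x y : ℕ → Fin 5) : Prop := ∀ k < n, x k = y k

/-- The cylinder of level `n` around `y` touches the one around `x`, from the right. -/
def RightNeighbor : ℕ → (ℕ → Fin 5) → (ℕ → Fin 5) → Prop
  | 0, _, _ => False
  | n + 1, x, y => (x 0 = y 0 ∧ RightNeighbor n (tailWord x) (tailWord y)) ∨
      (Adjacent (x 0) (y 0) ∧ (∀ k < n, tailWord x k = 2) ∧ ∀ k < n, tailWord y k = 0)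

/-- The cylinders of level `n` around `x` and `y` coincide or touch. -/
def Near (n : ℕ) (x y : ℕ → Fin 5) : Prop :=
  SamePrefix n x y ∨ RightNeighbor n x y ∨ RightNeighbor n y x

theorem Near.symm {n : ℕ} {x y : ℕ → Fin 5} (h : Near n x y) : Near n y x :=
  h.imp (fun h k hk => (h k hk).symm) Or.symm

theorem forall_lt_succ_iff {p : Fin 5 → ℕ → Prop} {n : ℕ} {x : ℕ → Fin 5} :
    (∀ k < n + 1, p (x k) k) ↔ p (x 0) 0 ∧ ∀ k < n, p (tailWord x k) (k + 1) := by
  refine ⟨fun h => ⟨h 0 (by omega), fun k hk => h (k + 1) (by omega)⟩, fun h k hk => ?_⟩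
  cases k with
  | zero => exact h.1
  | succ k => exact h.2 k (by omega)

theorem samePrefix_succ {n : ℕ} {x y : ℕ → Fin 5} :
    SamePrefix (n + 1) x y ↔ x 0 = y 0 ∧ SamePrefix n (tailWord x) (tailWord y) :=
  forall_lt_succ_iff (p := fun t k => t = y k)

theorem near_succ {n : ℕ} {x y : ℕ → Fin 5} :
    Near (n + 1) x y ↔ (x 0 = y 0 ∧ Near n (tailWord x) (tailWord y)) ∨
      (Adjacent (x 0) (y 0) ∧ (∀ k < n, tailWord x k = 2) ∧ ∀ k < n, tailWord y k = 0) ∨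
      (Adjacent (y 0) (x 0) ∧ (∀ k < n, tailWord y k = 2) ∧ ∀ k < n, tailWord x k = 0) := by
  simp only [Near, samePrefix_succ, RightNeighbor, eq_comm (a := y 0)]
  tauto

/-- The letter 2 is never the left member of an adjacent pair: the chain ends there. -/
theorem not_rightNeighbor_of_forall_eq_two {n : ℕ} {x y : ℕ → Fin 5} (hx : ∀ k < n, x k = 2) :
    ¬ RightNeighbor n x y := by
  induction n generalizing x y with
  | zero => exact id
  | succ n ih =>
    obtain ⟨h0, hx⟩ := (forall_lt_succ_iff (p := fun t _ => t = 2)).1 hx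
    rintro (⟨-, h⟩ | ⟨h, -⟩)
    · exact ih hx h
    · simp [Adjacent, h0] at h

theorem not_rightNeighbor_of_forall_eq_zero {n : ℕ} {x y : ℕ → Fin 5} (hy : ∀ k < n, y k = 0) :
    ¬ RightNeighbor n x y := by
  induction n generalizing x y with
  | zero => exact id
  | succ n ih =>
    obtain ⟨h0, hy⟩ := (forall_lt_succ_iff (p := fun t _ => t = 0)).1 hy
    rintro (⟨-, h⟩ | ⟨h, -⟩)
    · exact ih hy h
    · simp [Adjacent, h0] at h

/-- Right neighbors are unique at each level. With the mirror statement, a cylinder is near at most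
three cylinders, which is the 3 in `bernoulli_near_le`. -/
theorem RightNeighbor.samePrefix {n : ℕ} {x y z : ℕ → Fin 5} (hy : RightNeighbor n x y)
    (hz : RightNeighbor n x z) : SamePrefix n y z := by
  induction n generalizing x y z with
  | zero => exact hy.elim
  | succ n ih =>
    rw [samePrefix_succ]
    rcases hy with ⟨h0, hy⟩ | ⟨h0, hx, hy⟩ <;> rcases hz with ⟨h1, hz⟩ | ⟨h1, hx', hz⟩
    · exact ⟨h0.symm.trans h1, ih hy hz⟩
    · exact (not_rightNeighbor_of_forall_eq_two hx' hy).elim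
    · exact (not_rightNeighbor_of_forall_eq_two hx hz).elim
    · refine ⟨?_, fun k hk => (hy k hk).trans (hz k hk).symm⟩
      unfold Adjacent at h0 h1
      grind

theorem RightNeighbor.samePrefix_left {n : ℕ} {x y z : ℕ → Fin 5} (hy : RightNeighbor n y x)
    (hz : RightNeighbor n z x) : SamePrefix n y z := by
  induction n generalizing x y z with
  | zero => exact hy.elim
  | succ n ih =>
    rw [samePrefix_succ]
    rcases hy with ⟨h0, hy⟩ | ⟨h0, hy, hx⟩ <;> rcases hz with ⟨h1, hz⟩ | ⟨h1, hz, hx'⟩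
    · exact ⟨h0.trans h1.symm, ih hy hz⟩
    · exact (not_rightNeighbor_of_forall_eq_zero hx' hy).elim
    · exact (not_rightNeighbor_of_forall_eq_zero hx hz).elim
    · refine ⟨?_, fun k hk => (hy k hk).trans (hz k hk).symm⟩
      unfold Adjacent at h0 h1
      grind

/-! ### Distances in a chain. -/

namespace DigitTransducer

variable {Q : Type*}

/-- The letters `0`, `1`, `2` produce a chain of touching pieces along the real axis, and all other
pairs of pieces are uniformly separated. -/
structure IsChain (A : DigitTransducer Q) (B ε : ℝ) : Prop where
  pos : 0 < ε
  le_one : ε ≤ 1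
  norm_digit_le : ∀ q t, ‖A.digit q t‖ ≤ B
  digit_zero : ∀ q, A.digit q 0 = 0
  digit_one : ∀ q, A.digit q 1 = 1
  digit_two : ∀ q, A.digit q 2 = 2
  digit_three_re : ∀ q, (A.digit q 3).re = 2
  digit_four_re : ∀ q, (A.digit q 4).re = 1
  separated : ∀ q i j, i < j → ¬ Adjacent i j → ∀ z ∈ A.tile (A.next q i),
    ∀ w ∈ A.tile (A.next q j), ε ≤ ‖z + A.digit q i - (w + A.digit q j)‖
  separated_end : ∀ q, ∀ z ∈ A.tile (A.next q 3), ε ≤ ‖z + A.digit q 3 - 3‖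
  eq_of_subharmonic : ∀ h : Q → ℝ, (∀ q, 5 * h q ≤ ∑ t, h (A.next q t)) → ∀ q q', h q = h q'

variable {A : DigitTransducer Q} {B ε : ℝ}

namespace IsChain

theorem digit_re_bounds (hA : A.IsChain B ε) (q : Q) (t : Fin 5) :
    0 ≤ (A.digit q t).re ∧ (A.digit q t).re ≤ 2 ∧ (t ≠ 0 → 1 ≤ (A.digit q t).re) ∧
      (t ≠ 2 → t ≠ 3 → (A.digit q t).re ≤ 1) := by
  fin_cases t <;> simp [hA.digit_zero, hA.digit_one, hA.digit_two, hA.digit_three_re,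
    hA.digit_four_re]

theorem bound_nonneg (hA : A.IsChain B ε) (q : Q) : 0 ≤ B :=
  (norm_nonneg _).trans (hA.norm_digit_le q 0)

/-- The last bound puts the tile in a cone at its left end 0, so that pieces meeting there cannot be
tangent. A nonzero first letter forces real part at least 1/3, and there ‖z‖ ≤ B/2 gives the
constant 3B/2; the letter 0 only rescales. -/
theorem tile_bounds (hA : A.IsChain B ε) (q : Q) {z : ℂ} (hz : z ∈ A.tile q) :
    0 ≤ z.re ∧ z.re ≤ 1 ∧ ‖z‖ ≤ 3 * B / 2 * z.re := by
  have hB := hA.bound_nonneg q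
  suffices A.tile q ⊆ {z | ‖z‖ ≤ B / 2 ∧ 0 ≤ z.re ∧ z.re ≤ 1 ∧ ‖z‖ ≤ 3 * B / 2 * z.re} from
    (this hz).2
  refine tile_subset hA.norm_digit_le
    (S := fun _ => {z | ‖z‖ ≤ B / 2 ∧ 0 ≤ z.re ∧ z.re ≤ 1 ∧ ‖z‖ ≤ 3 * B / 2 * z.re}) (R := 0)
    (fun _ => ⟨0, ?_, by simp⟩) (fun _ => ?_) (fun q t w hw => ?_) q
  · simp only [mem_ofPred_eq, norm_zero, Complex.zero_re]
    exact ⟨by positivity, le_rfl, zero_le_one, by simp⟩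
  · exact (isClosed_le continuous_norm continuous_const).inter <|
      (isClosed_le continuous_const Complex.continuous_re).inter <|
      (isClosed_le Complex.continuous_re continuous_const).inter <|
      isClosed_le continuous_norm (continuous_const.mul Complex.continuous_re)
  · obtain ⟨h1, h2, h3, h4⟩ := hw
    obtain ⟨d0, d1, d2, -⟩ := hA.digit_re_bounds q t
    have hre : ((w + A.digit q t) / 3).re = (w.re + (A.digit q t).re) / 3 := by
      rw [Complex.div_ofNat_re, Complex.add_re]
    have hn : ‖(w + A.digit q t) / 3‖ ≤ B / 2 := by
      rw [norm_div, Complex.norm_ofNat]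
      linarith [norm_add_le w (A.digit q t), hA.norm_digit_le q t]
    refine ⟨hn, by rw [hre]; linarith, by rw [hre]; linarith, ?_⟩
    rw [hre]
    by_cases ht : t = 0
    · subst ht
      rw [hA.digit_zero, add_zero, norm_div, Complex.norm_ofNat, Complex.zero_re]
      linarith
    · refine hn.trans ?_
      nlinarith [d2 ht]

theorem le_re_point (hA : A.IsChain B ε) {n : ℕ} (q : Q) {x : ℕ → Fin 5}
    (hx : ¬ ∀ k < n, x k = 0) : (1 / 3) ^ n ≤ (A.point q x).re := by
  induction n generalizing q x with
  | zero => simp at hx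
  | succ n ih =>
    rw [forall_lt_succ_iff (p := fun t _ => t = 0)] at hx
    rw [point_eq hA.norm_digit_le, Complex.div_ofNat_re, Complex.add_re, pow_succ]
    by_cases h0 : x 0 = 0
    · have := ih (A.next q (x 0)) (x := tailWord x) fun h => hx ⟨h0, h⟩
      rw [h0] at this ⊢
      rw [hA.digit_zero, Complex.zero_re]
      linarith
    · have h1 := (hA.tile_bounds _ (A.point_mem_tile (A.next q (x 0)) (tailWord x))).1
      have h2 := (hA.digit_re_bounds q (x 0)).2.2.1 h0
      have h3 : (1 / 3 : ℝ) ^ n ≤ 1 := pow_le_one₀ (by norm_num) (by norm_num)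
      linarith

theorem le_norm_point_sub_one (hA : A.IsChain B ε) {n : ℕ} (q : Q) {x : ℕ → Fin 5}
    (hx : ¬ ∀ k < n, x k = 2) : ε * (1 / 3) ^ n ≤ ‖A.point q x - 1‖ := by
  induction n generalizing q x with
  | zero => simp at hx
  | succ n ih =>
    rw [forall_lt_succ_iff (p := fun t _ => t = 2)] at hx
    have heq : ‖A.point q x - 1‖
        = ‖A.point (A.next q (x 0)) (tailWord x) + A.digit q (x 0) - 3‖ / 3 := by
      rw [point_eq hA.norm_digit_le, ← Complex.norm_ofNat 3, ← norm_div]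
      congr 1
      ring
    rw [heq, pow_succ]
    have h3 : (1 / 3 : ℝ) ^ n ≤ 1 := pow_le_one₀ (by norm_num) (by norm_num)
    have hpos := hA.pos
    by_cases h0 : x 0 = 2
    · have := ih (A.next q (x 0)) (x := tailWord x) fun h => hx ⟨h0, h⟩
      rw [h0] at this ⊢
      rw [hA.digit_two, show A.point (A.next q 2) (tailWord x) + 2 - 3
        = A.point (A.next q 2) (tailWord x) - 1 by ring]
      linarith
    -- Letters other than 2 and 3 keep the real part of the numerator at most 2, hence at distance 1
    -- from 3. The letter 3 may reach beyond, which is why `separated_end` is needed.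
    · by_cases h1 : x 0 = 3
      · have := hA.separated_end q _ (A.point_mem_tile (A.next q 3) (tailWord x))
        rw [h1]
        nlinarith
      · have h4 := (hA.tile_bounds _ (A.point_mem_tile (A.next q (x 0)) (tailWord x))).2.1
        have h5 := (hA.digit_re_bounds q (x 0)).2.2.2 h0 h1
        have h6 := Complex.abs_re_le_norm
          (A.point (A.next q (x 0)) (tailWord x) + A.digit q (x 0) - 3)
        rw [Complex.sub_re, Complex.add_re, Complex.re_ofNat] at h6
        have := (abs_le.1 h6).1
        nlinarith [hA.le_one]

theorem norm_point_le_of_forall_eq_zero (hA : A.IsChain B ε) {n : ℕ} (q : Q) {x : ℕ → Fin 5}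
    (hx : ∀ k < n, x k = 0) : ‖A.point q x‖ ≤ B / 2 * (1 / 3) ^ n := by
  induction n generalizing q x with
  | zero => simpa using norm_point_le hA.norm_digit_le q x
  | succ n ih =>
    obtain ⟨h0, hx⟩ := (forall_lt_succ_iff (p := fun t _ => t = 0)).1 hx
    rw [point_eq hA.norm_digit_le, h0, hA.digit_zero, add_zero, norm_div, Complex.norm_ofNat,
      pow_succ]
    linarith [ih (A.next q 0) hx]

theorem norm_point_sub_one_le_of_forall_eq_two (hA : A.IsChain B ε) {n : ℕ} (q : Q)
    {x : ℕ → Fin 5} (hx : ∀ k < n, x k = 2) : ‖A.point q x - 1‖ ≤ (B / 2 + 1) * (1 / 3) ^ n := by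
  induction n generalizing q x with
  | zero =>
    simpa using (norm_sub_le _ _).trans (add_le_add_left (norm_point_le hA.norm_digit_le q x) ‖(1 : ℂ)‖)
  | succ n ih =>
    obtain ⟨h0, hx⟩ := (forall_lt_succ_iff (p := fun t _ => t = 2)).1 hx
    rw [point_eq hA.norm_digit_le, h0, hA.digit_two,
      show (A.point (A.next q 2) (tailWord x) + 2) / 3 - 1
        = (A.point (A.next q 2) (tailWord x) - 1) / 3 by ring, norm_div, Complex.norm_ofNat,
      pow_succ]
    linarith [ih (A.next q 2) hx]

theorem norm_sub_le_of_adjacent (hA : A.IsChain B ε) {n : ℕ} (q : Q) {x y : ℕ → Fin 5}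
    (h : Adjacent (x 0) (y 0)) (hx : ∀ k < n, tailWord x k = 2) (hy : ∀ k < n, tailWord y k = 0) :
    ‖A.point q x - A.point q y‖ ≤ (B + 1) * (1 / 3) ^ (n + 1) := by
  have hd : A.digit q (y 0) = A.digit q (x 0) + 1 := by
    rcases h with ⟨h, h'⟩ | ⟨h, h'⟩ <;> rw [h, h'] <;>
      norm_num [hA.digit_zero, hA.digit_one, hA.digit_two]
  rw [point_eq hA.norm_digit_le q x, point_eq hA.norm_digit_le q y, hd]
  set u := A.point (A.next q (x 0)) (tailWord x)
  set v := A.point (A.next q (y 0)) (tailWord y)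
  rw [show (u + A.digit q (x 0)) / 3 - (v + (A.digit q (x 0) + 1)) / 3 = ((u - 1) - v) / 3 by ring,
    norm_div, Complex.norm_ofNat, pow_succ]
  have h1 := hA.norm_point_sub_one_le_of_forall_eq_two (A.next q (x 0)) hx
  have h2 := hA.norm_point_le_of_forall_eq_zero (A.next q (y 0)) hy
  linarith [norm_sub_le (u - 1) v]

theorem norm_sub_le_of_near (hA : A.IsChain B ε) {n : ℕ} (q : Q) {x y : ℕ → Fin 5}
    (h : Near n x y) : ‖A.point q x - A.point q y‖ ≤ (B + 1) * (1 / 3) ^ n := by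
  induction n generalizing q x y with
  | zero =>
    have h1 := norm_point_le hA.norm_digit_le q x
    have h2 := norm_point_le hA.norm_digit_le q y
    rw [pow_zero]
    linarith [norm_sub_le (A.point q x) (A.point q y)]
  | succ n ih =>
    rcases near_succ.1 h with ⟨h0, h⟩ | ⟨h, hx, hy⟩ | ⟨h, hy, hx⟩
    · rw [point_eq hA.norm_digit_le q x, point_eq hA.norm_digit_le q y, ← h0, ← sub_div,
        add_sub_add_right_eq_sub, norm_div, Complex.norm_ofNat, pow_succ]
      linarith [ih (A.next q (x 0)) h]
    · exact hA.norm_sub_le_of_adjacent q h hx hy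
    · rw [norm_sub_rev]
      exact hA.norm_sub_le_of_adjacent q h hy hx

/-- Seen from the contact point, the left piece has real part at most 0 and the right one lies in
the cone of `tile_bounds`. So the distance bounds Re v, therefore ‖v‖, therefore ‖u - 1‖, and one of
these is large unless both words stay at the contact. -/
theorem le_norm_sub_of_adjacent (hA : A.IsChain B ε) {n : ℕ} (q : Q) {x y : ℕ → Fin 5}
    (h : Adjacent (x 0) (y 0))
    (hxy : ¬ ((∀ k < n, tailWord x k = 2) ∧ ∀ k < n, tailWord y k = 0)) :
    ε / (3 * B / 2 + 1) * (1 / 3) ^ (n + 1) ≤ ‖A.point q x - A.point q y‖ := by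
  have hB := hA.bound_nonneg q
  have hd : A.digit q (y 0) = A.digit q (x 0) + 1 := by
    rcases h with ⟨h, h'⟩ | ⟨h, h'⟩ <;> rw [h, h'] <;>
      norm_num [hA.digit_zero, hA.digit_one, hA.digit_two]
  have hu := hA.tile_bounds _ (A.point_mem_tile (A.next q (x 0)) (tailWord x))
  have hv := hA.tile_bounds _ (A.point_mem_tile (A.next q (y 0)) (tailWord y))
  have hu2 := hA.le_norm_point_sub_one (n := n) (A.next q (x 0)) (x := tailWord x)
  have hv2 := hA.le_re_point (n := n) (A.next q (y 0)) (x := tailWord y)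
  rw [point_eq hA.norm_digit_le q x, point_eq hA.norm_digit_le q y, hd]
  set u := A.point (A.next q (x 0)) (tailWord x)
  set v := A.point (A.next q (y 0)) (tailWord y)
  rw [norm_sub_rev, show (v + (A.digit q (x 0) + 1)) / 3 - (u + A.digit q (x 0)) / 3
    = (v - (u - 1)) / 3 by ring, norm_div, Complex.norm_ofNat, pow_succ]
  have h1 : v.re ≤ ‖v - (u - 1)‖ := by
    have := (le_abs_self _).trans (Complex.abs_re_le_norm (v - (u - 1)))
    rw [Complex.sub_re, Complex.sub_re, Complex.one_re] at this
    linarith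
  have key : ε * (1 / 3) ^ n ≤ (3 * B / 2 + 1) * ‖v - (u - 1)‖ := by
    have hp : (0 : ℝ) < (1 / 3) ^ n := by positivity
    by_cases hy : ∀ k < n, tailWord y k = 0
    · have h2 := hu2 fun hx => hxy ⟨hx, hy⟩
      have h3 : ‖u - 1‖ ≤ ‖v‖ + ‖v - (u - 1)‖ := by
        simpa using norm_sub_le v (v - (u - 1))
      nlinarith
    · have h2 := hv2 hy
      nlinarith [hA.le_one, mul_nonneg hB (norm_nonneg (v - (u - 1)))]
  have hpos : 0 < 3 * B / 2 + 1 := by positivity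
  rw [div_mul_eq_mul_div, div_le_iff₀ hpos]
  linarith

theorem le_norm_sub_of_not_near (hA : A.IsChain B ε) {n : ℕ} (q : Q) {x y : ℕ → Fin 5}
    (h : ¬ Near n x y) :
    ε / (3 * B / 2 + 1) * (1 / 3) ^ n ≤ ‖A.point q x - A.point q y‖ := by
  have hB := hA.bound_nonneg q
  have hpos := hA.pos
  have hc : ε / (3 * B / 2 + 1) ≤ ε := div_le_self hpos.le (by linarith)
  have hfar : ∀ q, ∀ i j : Fin 5, i < j → ¬ Adjacent i j → ∀ z ∈ A.tile (A.next q i),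
      ∀ w ∈ A.tile (A.next q j), ∀ n : ℕ, ε / (3 * B / 2 + 1) * (1 / 3) ^ (n + 1) ≤
        ‖(z + A.digit q i) / 3 - (w + A.digit q j) / 3‖ := by
    intro q i j hij hadj z hz w hw n
    rw [← sub_div, norm_div, Complex.norm_ofNat, pow_succ]
    have h1 := hA.separated q i j hij hadj z hz w hw
    have h3 : (1 / 3 : ℝ) ^ n ≤ 1 := pow_le_one₀ (by norm_num) (by norm_num)
    have h4 : 0 ≤ ε / (3 * B / 2 + 1) := by positivity
    nlinarith
  clear hB
  induction n generalizing q x y with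
  | zero => exact (h (Or.inl fun k hk => by omega)).elim
  | succ n ih =>
    rw [near_succ] at h
    push Not at h
    obtain ⟨h1, h2, h3⟩ := h
    rcases lt_trichotomy (x 0) (y 0) with h0 | h0 | h0
    · by_cases hadj : Adjacent (x 0) (y 0)
      · exact hA.le_norm_sub_of_adjacent q hadj fun h => by
          obtain ⟨k, hk, hne⟩ := h2 hadj h.1
          exact hne (h.2 k hk)
      · rw [point_eq hA.norm_digit_le q x, point_eq hA.norm_digit_le q y]
        exact hfar q _ _ h0 hadj _ (A.point_mem_tile _ _) _ (A.point_mem_tile _ _) n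
    · rw [point_eq hA.norm_digit_le q x, point_eq hA.norm_digit_le q y, ← h0, ← sub_div,
        add_sub_add_right_eq_sub, norm_div, Complex.norm_ofNat, pow_succ]
      linarith [ih (A.next q (x 0)) (h1 h0)]
    · rw [norm_sub_rev]
      by_cases hadj : Adjacent (y 0) (x 0)
      · exact hA.le_norm_sub_of_adjacent q hadj fun h => by
          obtain ⟨k, hk, hne⟩ := h3 hadj h.1
          exact hne (h.2 k hk)
      · rw [point_eq hA.norm_digit_le q x, point_eq hA.norm_digit_le q y]
        exact hfar q _ _ h0 hadj _ (A.point_mem_tile _ _) _ (A.point_mem_tile _ _) n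

end IsChain

end DigitTransducer

/-! ### Codings: comparison of metrics, and positive finite Hausdorff measure. -/

/-- A continuous parametrization by words under which the distance of two points is comparable to
`3 ^ (-n)`, where `n` is the first level at which their cylinders are not near each other. -/
structure IsCoding (Ψ : (ℕ → Fin 5) → ℂ) (C c : ℝ) : Prop where
  continuous : Continuous Ψ
  pos : 0 < c
  dist_le : ∀ n x y, Near n x y → dist (Ψ x) (Ψ y) ≤ C * (1 / 3) ^ n
  le_dist : ∀ n x y, ¬ Near n x y → c * (1 / 3) ^ n ≤ dist (Ψ x) (Ψ y)

/-- The first `n` letters of a word. -/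
def wordPrefix (n : ℕ) (x : ℕ → Fin 5) : Fin n → Fin 5 := fun k => x k

/-- A word with the given first letters. -/
def extendWord {n : ℕ} (w : Fin n → Fin 5) : ℕ → Fin 5 :=
  fun k => if h : k < n then w ⟨k, h⟩ else 0

theorem wordPrefix_extendWord {n : ℕ} (w : Fin n → Fin 5) : wordPrefix n (extendWord w) = w := by
  funext k
  simp [wordPrefix, extendWord]

theorem wordPrefix_eq_iff {n : ℕ} {x y : ℕ → Fin 5} :
    wordPrefix n x = wordPrefix n y ↔ SamePrefix n x y :=
  ⟨fun h k hk => congrFun h ⟨k, hk⟩, fun h => funext fun k => h k k.2⟩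

theorem continuous_wordPrefix (n : ℕ) : Continuous (wordPrefix n) :=
  continuous_pi fun k => continuous_apply (k : ℕ)

theorem near_zero (x y : ℕ → Fin 5) : Near 0 x y := Or.inl fun k hk => by omega

namespace IsCoding

variable {Ψ : (ℕ → Fin 5) → ℂ} {C c : ℝ}

theorem bound_nonneg (h : IsCoding Ψ C c) : 0 ≤ C := by
  simpa using dist_nonneg.trans (h.dist_le 0 (fun _ => 0) (fun _ => 0) (near_zero _ _))

theorem isometry_comp (h : IsCoding Ψ C c) {g : ℂ → ℂ} (hg : Isometry g) :
    IsCoding (fun x => g (Ψ x)) C c where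
  continuous := hg.continuous.comp h.continuous
  pos := h.pos
  dist_le n x y hxy := (hg.dist_eq _ _).trans_le (h.dist_le n x y hxy)
  le_dist n x y hxy := (h.le_dist n x y hxy).trans_eq (hg.dist_eq _ _).symm

/-- Nearness does not depend on the coding. If n + 1 is the first level without it, level n bounds
one distance above and level n + 1 the other below; the factor 3 is this gap of one level. -/
theorem dist_le_mul_dist {Ψ' : (ℕ → Fin 5) → ℂ} {C' c' : ℝ} (h : IsCoding Ψ C c)
    (h' : IsCoding Ψ' C' c') (x y : ℕ → Fin 5) :
    dist (Ψ x) (Ψ y) ≤ 3 * C / c' * dist (Ψ' x) (Ψ' y) := by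
  have hC := h.bound_nonneg
  have hc' := h'.pos
  by_cases hxy : ∀ n, Near n x y
  · have : dist (Ψ x) (Ψ y) = 0 := dist_eq_zero.2 <| by
      refine mem_singleton_iff.1 (mem_of_forall_dist_le (R := C) isClosed_singleton fun n => ?_)
      exact ⟨_, rfl, h.dist_le n x y (hxy n)⟩
    rw [this]
    positivity
  · push Not at hxy
    classical
    obtain ⟨n, hn⟩ : ∃ n, Nat.find hxy = n + 1 :=
      Nat.exists_eq_succ_of_ne_zero fun h0 => Nat.find_spec hxy (h0 ▸ near_zero x y)
    have h1 := h.dist_le n x y (not_not.1 (Nat.find_min hxy (by omega)))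
    have h2 := h'.le_dist (n + 1) x y (hn ▸ Nat.find_spec hxy)
    rw [pow_succ] at h2
    calc _ ≤ C * (1 / 3) ^ n := h1
      _ = 3 * C / c' * (c' * ((1 / 3) ^ n * (1 / 3))) := by field_simp
      _ ≤ _ := by gcongr

theorem isCompact_range (h : IsCoding Ψ C c) : IsCompact (range Ψ) :=
  _root_.isCompact_range h.continuous

theorem isCompact_image_wordPrefix (h : IsCoding Ψ C c) {n : ℕ} (P : Set (Fin n → Fin 5)) :
    IsCompact (Ψ '' (wordPrefix n ⁻¹' P)) :=
  ((isClosed_discrete P).preimage (continuous_wordPrefix n)).isCompact.image h.continuous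

/-- The letter 4 is adjacent to no other, so its first-level cylinder splits off as a closed piece.
-/
theorem not_isConnected_range (h : IsCoding Ψ C c) : ¬ IsConnected (range Ψ) := by
  intro hconn
  have h1 := isPreconnected_closed_iff.1 hconn.isPreconnected
    _ _ (h.isCompact_image_wordPrefix {w : Fin 1 → Fin 5 | w 0 = 4}).isClosed
    (h.isCompact_image_wordPrefix {w : Fin 1 → Fin 5 | w 0 ≠ 4}).isClosed ?_
    ⟨Ψ fun _ => 4, mem_range_self _, mem_image_of_mem _ rfl⟩
    ⟨Ψ fun _ => 0, mem_range_self _, mem_image_of_mem _ (show (0 : Fin 5) ≠ 4 by decide)⟩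
  · obtain ⟨_, -, ⟨x, hx, rfl⟩, ⟨y, hy, hxy⟩⟩ := h1
    have hx : x 0 = 4 := hx
    have hy : y 0 ≠ 4 := hy
    have hnear : ¬ Near 1 x y := by
      rw [near_succ]
      simp only [Adjacent, hx]
      grind
    have := h.le_dist 1 x y hnear
    rw [hxy, dist_self] at this
    linarith [h.pos]
  · rintro _ ⟨x, rfl⟩
    by_cases hx : x 0 = 4
    · exact Or.inl (mem_image_of_mem _ hx)
    · exact Or.inr (mem_image_of_mem _ hx)

variable {s : ℝ}

theorem ediam_image_le (h : IsCoding Ψ C c) {n : ℕ} (w : Fin n → Fin 5) :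
    Metric.ediam (Ψ '' (wordPrefix n ⁻¹' {w})) ≤ ENNReal.ofReal (C * (1 / 3) ^ n) := by
  refine Metric.ediam_le ?_
  rintro _ ⟨x, hx, rfl⟩ _ ⟨y, hy, rfl⟩
  rw [edist_dist]
  refine ENNReal.ofReal_le_ofReal (h.dist_le n x y (Or.inl ?_))
  exact wordPrefix_eq_iff.1 ((mem_singleton_iff.1 hx).trans (mem_singleton_iff.1 hy).symm)

theorem pow_rpow_eq (hs : (3 : ℝ) ^ s = 5) (n : ℕ) : ((1 / 3 : ℝ) ^ n) ^ s = (1 / 5) ^ n := by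
  rw [← Real.rpow_natCast, ← Real.rpow_mul (by norm_num), mul_comm, Real.rpow_mul (by norm_num),
    Real.div_rpow (by norm_num) (by norm_num), hs, Real.one_rpow, Real.rpow_natCast]

/-- The 5^n cylinders of level n have diameter at most C 3^(-n), and 3^s = 5, so the covering sums
stay below C^s. -/
theorem hausdorffMeasure_range_lt_top (h : IsCoding Ψ C c) (hs0 : 0 < s) (hs : (3 : ℝ) ^ s = 5) :
    μH[s] (range Ψ) < ∞ := by
  have hC := h.bound_nonneg
  have hlim : Filter.Tendsto (fun n : ℕ => ENNReal.ofReal (C * (1 / 3) ^ n)) Filter.atTop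
      (nhds 0) := by
    rw [← ENNReal.ofReal_zero]
    refine ENNReal.tendsto_ofReal ?_
    simpa using (tendsto_pow_atTop_nhds_zero_of_lt_one (by norm_num : (0 : ℝ) ≤ 1 / 3)
      (by norm_num)).const_mul C
  refine (Measure.hausdorffMeasure_le_liminf_sum s (range Ψ) _ hlim
    (fun n (w : Fin n → Fin 5) => Ψ '' (wordPrefix n ⁻¹' {w}))
    (.of_forall fun n w => h.ediam_image_le w) (.of_forall fun n => ?_)).trans_lt ?_
  · rintro _ ⟨x, rfl⟩
    exact mem_iUnion.2 ⟨wordPrefix n x, x, rfl, rfl⟩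
  · refine (Filter.liminf_le_liminf (.of_forall fun n =>
      (Finset.sum_le_card_nsmul _ _ (ENNReal.ofReal (C ^ s * (1 / 5) ^ n)) fun w _ => ?_ : _ ≤ _))
      ).trans_lt ?_
    · refine (ENNReal.rpow_le_rpow (h.ediam_image_le w) hs0.le).trans_eq ?_
      rw [ENNReal.ofReal_rpow_of_nonneg (by positivity) hs0.le,
        Real.mul_rpow hC (by positivity), pow_rpow_eq hs]
    · have : ∀ n : ℕ, (Finset.univ : Finset (Fin n → Fin 5)).card •
          ENNReal.ofReal (C ^ s * (1 / 5) ^ n) = ENNReal.ofReal (C ^ s) := by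
        intro n
        rw [← ENNReal.ofReal_nsmul, Finset.card_univ, Fintype.card_fun, Fintype.card_fin,
          Fintype.card_fin, nsmul_eq_mul]
        congr 1
        push_cast
        rw [mul_left_comm, ← mul_pow]
        norm_num
      simp only [this, Filter.liminf_const, ENNReal.ofReal_lt_top]

/-- The uniform Bernoulli measure on words. -/
noncomputable def bernoulli : Measure (ℕ → Fin 5) :=
  Measure.infinitePi fun _ => (PMF.uniformOfFintype (Fin 5)).toMeasure

theorem bernoulli_samePrefix (n : ℕ) (x : ℕ → Fin 5) :
    bernoulli {y | SamePrefix n x y} = (5 : ℝ≥0∞)⁻¹ ^ n := by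
  have : {y | SamePrefix n x y} = Set.pi (Finset.range n) fun k => {x k} := by
    ext y
    simp [SamePrefix, eq_comm]
  rw [this, bernoulli, Measure.infinitePi_pi _ fun _ _ => measurableSet_singleton _]
  simp

theorem bernoulli_le_of_forall_samePrefix {n : ℕ} {S : Set (ℕ → Fin 5)}
    (hS : ∀ x ∈ S, ∀ y ∈ S, SamePrefix n x y) : bernoulli S ≤ (5 : ℝ≥0∞)⁻¹ ^ n := by
  rcases S.eq_empty_or_nonempty with rfl | ⟨x, hx⟩
  · simp
  · exact (measure_mono fun y hy => hS x hx y hy).trans_eq (bernoulli_samePrefix n x)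

theorem bernoulli_near_le (n : ℕ) (x : ℕ → Fin 5) :
    bernoulli {y | Near n x y} ≤ 3 * (5 : ℝ≥0∞)⁻¹ ^ n := by
  have hsub : {y | Near n x y} ⊆ {y | SamePrefix n x y} ∪
      ({y | RightNeighbor n x y} ∪ {y | RightNeighbor n y x}) := fun y hy => hy
  refine (measure_mono hsub).trans <| (measure_union_le _ _).trans <|
    (add_le_add (bernoulli_samePrefix n x).le <| (measure_union_le _ _).trans <| add_le_add
    (bernoulli_le_of_forall_samePrefix fun y hy z hz => RightNeighbor.samePrefix hy hz)
    (bernoulli_le_of_forall_samePrefix fun y hy z hz =>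
      RightNeighbor.samePrefix_left hy hz)).trans_eq ?_
  ring

theorem bernoulli_preimage_le (h : IsCoding Ψ C c) {n : ℕ} {U : Set ℂ}
    (hU : ∀ z ∈ U, ∀ w ∈ U, dist z w < c * (1 / 3) ^ n) :
    bernoulli (Ψ ⁻¹' U) ≤ 3 * (5 : ℝ≥0∞)⁻¹ ^ n := by
  rcases (Ψ ⁻¹' U).eq_empty_or_nonempty with h0 | ⟨x, hx⟩
  · simp [h0]
  · refine (measure_mono fun y hy => ?_).trans (bernoulli_near_le n x)
    by_contra hxy
    exact (hU _ hx _ hy).not_ge (h.le_dist n x y hxy)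

theorem bernoulli_preimage_le_ediam (h : IsCoding Ψ C c) (hs0 : 0 < s) (hs : (3 : ℝ) ^ s = 5)
    {U : Set ℂ} (hU : Metric.ediam U ≤ ENNReal.ofReal (c / 2)) :
    bernoulli (Ψ ⁻¹' U) ≤ ENNReal.ofReal (15 * (2 / c) ^ s) * Metric.ediam U ^ s := by
  have hc := h.pos
  have hfin : Metric.ediam U ≠ ∞ := (hU.trans_lt ENNReal.ofReal_lt_top).ne
  set d := (Metric.ediam U).toReal with hd
  have hd0 : 0 ≤ d := ENNReal.toReal_nonneg
  have hdU : Metric.ediam U = ENNReal.ofReal d := (ENNReal.ofReal_toReal hfin).symm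
  have hdist : ∀ z ∈ U, ∀ w ∈ U, dist z w ≤ d := fun z hz w hw => by
    rw [dist_edist]
    exact ENNReal.toReal_mono hfin (Metric.edist_le_ediam_of_mem hz hw)
  have hdc : d ≤ c / 2 := by
    rw [hdU] at hU
    exact (ENNReal.ofReal_le_ofReal_iff (by positivity)).1 hU
  have h5 : (5 : ℝ≥0∞)⁻¹ = ENNReal.ofReal (1 / 5) := by
    rw [one_div, ENNReal.ofReal_inv_of_pos (by norm_num)]
    simp
  rcases hd0.eq_or_lt with h0 | hpos
  · have hle : ∀ n : ℕ, bernoulli (Ψ ⁻¹' U) ≤ 3 * (5 : ℝ≥0∞)⁻¹ ^ n := fun n =>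
      h.bernoulli_preimage_le fun z hz w hw => (hdist z hz w hw).trans_lt (by
        rw [← h0]
        positivity)
    have hlim : Filter.Tendsto (fun n : ℕ => 3 * (5 : ℝ≥0∞)⁻¹ ^ n) Filter.atTop (nhds 0) := by
      simpa using ENNReal.Tendsto.const_mul (ENNReal.tendsto_pow_atTop_nhds_zero_of_lt_one
        (r := (5 : ℝ≥0∞)⁻¹) (ENNReal.inv_lt_one.2 (by norm_num))) (a := 3) (Or.inr (by simp))
    exact (ge_of_tendsto' hlim hle).trans zero_le
  -- Here 3^(-n-1) < 2d/c ≤ 3^(-n). Halving c makes d < c 3^(-n) strict, and passing from level n to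
  -- n + 1 turns the constant 3 into 15.
  · obtain ⟨n, hn1, hn2⟩ := exists_nat_pow_near_of_lt_one (x := d / (c / 2)) (y := (1 / 3 : ℝ))
      (by positivity) (by rwa [div_le_one (by positivity)]) (by norm_num) (by norm_num)
    rw [div_le_iff₀ (by positivity)] at hn2
    have hp : (0 : ℝ) < (1 / 3) ^ n := by positivity
    refine (h.bernoulli_preimage_le (n := n) fun z hz w hw =>
      (hdist z hz w hw).trans_lt (by nlinarith)).trans ?_
    rw [hdU, ENNReal.ofReal_rpow_of_nonneg hd0 hs0.le, ← ENNReal.ofReal_mul (by positivity), h5,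
      ← ENNReal.ofReal_pow (by norm_num), ← ENNReal.ofReal_ofNat 3,
      ← ENNReal.ofReal_mul (by norm_num)]
    refine ENNReal.ofReal_le_ofReal ?_
    have h1 : ((1 / 3 : ℝ) ^ (n + 1)) ^ s ≤ (d / (c / 2)) ^ s :=
      Real.rpow_le_rpow (by positivity) hn1.le hs0.le
    rw [pow_rpow_eq hs, show d / (c / 2) = 2 / c * d by field_simp,
      Real.mul_rpow (by positivity) hd0, pow_succ] at h1
    linarith

theorem hausdorffMeasure_range_pos (h : IsCoding Ψ C c) (hs0 : 0 < s) (hs : (3 : ℝ) ^ s = 5) :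
    0 < μH[s] (range Ψ) := by
  have hc := h.pos
  set K := ENNReal.ofReal (15 * (2 / c) ^ s)
  have hK0 : K ≠ 0 := (ENNReal.ofReal_pos.2 (by positivity)).ne'
  have hle : K⁻¹ • bernoulli.map Ψ ≤ μH[s] := by
    refine Measure.le_hausdorffMeasure s _ (ENNReal.ofReal (c / 2))
      (ENNReal.ofReal_pos.2 (by positivity)) fun U hU => ?_
    rw [Measure.smul_apply, smul_eq_mul]
    -- An arbitrary U need not be measurable; its closure is, with the same diameter.
    have h1 := h.bernoulli_preimage_le_ediam hs0 hs (U := closure U) (by rwa [Metric.ediam_closure])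
    rw [Metric.ediam_closure, ← Measure.map_apply h.continuous.measurable
      isClosed_closure.measurableSet] at h1
    calc _ ≤ K⁻¹ * (K * Metric.ediam U ^ s) := by
          gcongr
          exact (measure_mono subset_closure).trans h1
      _ = _ := by rw [← mul_assoc, ENNReal.inv_mul_cancel hK0 ENNReal.ofReal_ne_top, one_mul]
  refine lt_of_lt_of_le ?_ (hle (range Ψ))
  have hprob : IsProbabilityMeasure bernoulli := by unfold bernoulli; infer_instance
  rw [Measure.smul_apply, smul_eq_mul, Measure.map_apply h.continuous.measurable
    h.isCompact_range.isClosed.measurableSet, preimage_range, measure_univ, mul_one]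
  exact ENNReal.inv_pos.2 ENNReal.ofReal_ne_top

end IsCoding

/-! ### Uniform cylinder measure and the recoding map. -/

namespace IsCoding

variable {Ψ Ψ' : (ℕ → Fin 5) → ℂ} {C c C' c' s : ℝ}

/-- All cylinders of the same level have the same `s`-dimensional Hausdorff measure, namely the
`5 ^ n`-th part of the measure of the whole set. -/
def IsUniform (s : ℝ) (Ψ : (ℕ → Fin 5) → ℂ) : Prop :=
  ∀ n x, μH[s] (Ψ '' {y | SamePrefix n x y}) = (5 : ℝ≥0∞)⁻¹ ^ n * μH[s] (range Ψ)

theorem IsUniform.isometry_comp (hu : IsUniform s Ψ) (hs0 : 0 < s) {g : ℂ → ℂ} (hg : Isometry g) :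
    IsUniform s fun x => g (Ψ x) := fun n x => by
  rw [← image_image g Ψ, show range (fun x => g (Ψ x)) = g '' range Ψ from range_comp g Ψ,
    hg.hausdorffMeasure_image (Or.inl hs0.le), hg.hausdorffMeasure_image (Or.inl hs0.le), hu n x]

/-- Subadditivity gives an upper bound for P and for its complement; the two bounds add up to the
finite total, so both are equalities. Overlaps of cylinders need no separate treatment. -/
theorem IsUniform.measure_image_wordPrefix (hu : IsUniform s Ψ) (hfin : μH[s] (range Ψ) ≠ ∞)
    {n : ℕ} (P : Finset (Fin n → Fin 5)) :
    μH[s] (Ψ '' (wordPrefix n ⁻¹' P)) = P.card * (5 : ℝ≥0∞)⁻¹ ^ n * μH[s] (range Ψ) := by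
  classical
  have hle : ∀ P : Finset (Fin n → Fin 5), μH[s] (Ψ '' (wordPrefix n ⁻¹' P)) ≤
      P.card * (5 : ℝ≥0∞)⁻¹ ^ n * μH[s] (range Ψ) := by
    intro P
    have hcov : Ψ '' (wordPrefix n ⁻¹' P) ⊆
        ⋃ w ∈ P, Ψ '' {y | SamePrefix n (extendWord w) y} := by
      rintro _ ⟨x, hx, rfl⟩
      refine mem_iUnion₂.2 ⟨_, hx, x, wordPrefix_eq_iff.1 (wordPrefix_extendWord _), rfl⟩
    refine (measure_mono hcov).trans <| (measure_biUnion_finset_le _ _).trans_eq ?_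
    simp only [hu n, Finset.sum_const, nsmul_eq_mul, mul_assoc]
  refine le_antisymm (hle P) ?_
  have h1 : μH[s] (range Ψ) ≤
      μH[s] (Ψ '' (wordPrefix n ⁻¹' P)) + μH[s] (Ψ '' (wordPrefix n ⁻¹' (Pᶜ : Finset _))) := by
    refine (measure_mono ?_).trans (measure_union_le _ _)
    rw [← image_union, ← preimage_union, Finset.coe_compl, union_compl_self, preimage_univ,
      image_univ]
  have h2 : (P.card + (Pᶜ : Finset _).card : ℝ≥0∞) * (5 : ℝ≥0∞)⁻¹ ^ n = 1 := by
    rw [← Nat.cast_add, Finset.card_add_card_compl, Fintype.card_fun, Fintype.card_fin,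
      Fintype.card_fin, Nat.cast_pow, ← mul_pow, Nat.cast_ofNat,
      ENNReal.mul_inv_cancel (by norm_num) (by norm_num), one_pow]
  have h3 : (Pᶜ : Finset _).card * (5 : ℝ≥0∞)⁻¹ ^ n * μH[s] (range Ψ) ≠ ∞ :=
    ENNReal.mul_ne_top (ENNReal.mul_ne_top (by simp) (by simp)) hfin
  refine (ENNReal.add_le_add_iff_right h3).1 ?_
  rw [← add_mul, ← add_mul, h2, one_mul]
  exact h1.trans (by gcongr; exact hle Pᶜ)

/-- The prefixes of length `n` of the words in `S`. -/
noncomputable def prefixes (n : ℕ) (S : Set (ℕ → Fin 5)) : Finset (Fin n → Fin 5) :=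
  (toFinite (wordPrefix n '' S)).toFinset

theorem mem_preimage_prefixes {n : ℕ} {S : Set (ℕ → Fin 5)} {y : ℕ → Fin 5} :
    y ∈ wordPrefix n ⁻¹' (prefixes n S : Set (Fin n → Fin 5)) ↔ ∃ x ∈ S, SamePrefix n x y := by
  simp [prefixes, wordPrefix_eq_iff]

/-- The unions of the level-n cylinders meeting K decrease to K ∩ range Ψ. Apart from the total
mass, the approximants depend only on the codes of K. -/
theorem IsUniform.tendsto_prefixes (h : IsCoding Ψ C c) (hu : IsUniform s Ψ)
    (hfin : μH[s] (range Ψ) ≠ ∞) {K : Set ℂ} (hK : IsClosed K) :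
    Filter.Tendsto (fun n => (prefixes n (Ψ ⁻¹' K)).card * (5 : ℝ≥0∞)⁻¹ ^ n * μH[s] (range Ψ))
      Filter.atTop (nhds (μH[s] (K ∩ range Ψ))) := by
  set T : ℕ → Set ℂ := fun n =>
    Ψ '' (wordPrefix n ⁻¹' (prefixes n (Ψ ⁻¹' K) : Set (Fin n → Fin 5))) with hT
  have hcompact : ∀ n, IsCompact (T n) := fun n => h.isCompact_image_wordPrefix _
  have hanti : Antitone T := by
    refine fun m n hmn => image_mono fun y hy => ?_
    rw [mem_preimage_prefixes] at hy ⊢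
    obtain ⟨x, hx, hxy⟩ := hy
    exact ⟨x, hx, fun k hk => hxy k (hk.trans_le hmn)⟩
  have hinter : ⋂ n, T n = K ∩ range Ψ := by
    apply subset_antisymm
    · intro z hz
      rw [mem_iInter] at hz
      refine ⟨mem_of_forall_dist_le hK (R := C) fun n => ?_, image_subset_range _ _ (hz 0)⟩
      obtain ⟨y, hy, rfl⟩ := hz n
      obtain ⟨x, hx, hxy⟩ := mem_preimage_prefixes.1 hy
      exact ⟨Ψ x, hx, h.dist_le n y x (Near.symm (Or.inl hxy))⟩
    · rintro _ ⟨hx, x, rfl⟩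
      exact mem_iInter.2 fun n =>
        mem_image_of_mem _ (mem_preimage_prefixes.2 ⟨x, hx, fun k _ => rfl⟩)
  have := tendsto_measure_iInter_atTop (μ := μH[s]) (s := T)
    (fun n => (hcompact n).isClosed.measurableSet.nullMeasurableSet) hanti
    ⟨0, ((measure_mono (image_subset_range _ _)).trans_lt hfin.lt_top).ne⟩
  rw [hinter] at this
  refine this.congr fun n => ?_
  exact hu.measure_image_wordPrefix hfin _

/-- The map that sends the point with a given code under `Ψ` to the one with the same code
under `Ψ'`. -/
noncomputable def recode (Ψ Ψ' : (ℕ → Fin 5) → ℂ) (z : ℂ) : ℂ := Ψ' (Function.invFun Ψ z)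

/-- The code chosen by `invFun` is irrelevant: codes of one point under Ψ have distance zero under
Ψ' as well. -/
theorem recode_apply (h : IsCoding Ψ C c) (h' : IsCoding Ψ' C' c') (x : ℕ → Fin 5) :
    recode Ψ Ψ' (Ψ x) = Ψ' x := by
  have h1 : Ψ (Function.invFun Ψ (Ψ x)) = Ψ x := Function.invFun_eq ⟨x, rfl⟩
  have h2 := h'.dist_le_mul_dist h (Function.invFun Ψ (Ψ x)) x
  rw [h1, dist_self, mul_zero] at h2
  exact dist_le_zero.1 h2

theorem bijOn_recode (h : IsCoding Ψ C c) (h' : IsCoding Ψ' C' c') :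
    BijOn (recode Ψ Ψ') (range Ψ) (range Ψ') := by
  refine ⟨?_, ?_, ?_⟩
  · rintro _ ⟨x, rfl⟩
    exact ⟨x, (recode_apply h h' x).symm⟩
  · rintro _ ⟨x, rfl⟩ _ ⟨y, rfl⟩ hxy
    rw [recode_apply h h', recode_apply h h'] at hxy
    have h2 := h.dist_le_mul_dist h' x y
    rw [hxy, dist_self, mul_zero] at h2
    exact dist_le_zero.1 h2
  · rintro _ ⟨x, rfl⟩
    exact ⟨Ψ x, ⟨x, rfl⟩, recode_apply h h' x⟩

theorem dist_recode_le (h : IsCoding Ψ C c) (h' : IsCoding Ψ' C' c') :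
    ∀ z ∈ range Ψ, ∀ w ∈ range Ψ,
      dist (recode Ψ Ψ' z) (recode Ψ Ψ' w) ≤ 3 * C' / c * dist z w := by
  rintro _ ⟨x, rfl⟩ _ ⟨y, rfl⟩
  rw [recode_apply h h', recode_apply h h']
  exact h'.dist_le_mul_dist h x y

theorem isBiLipschitzOn_recode (h : IsCoding Ψ C c) (h' : IsCoding Ψ' C' c') :
    IsBiLipschitzOn (recode Ψ Ψ') (range Ψ) (range Ψ') := by
  refine ⟨bijOn_recode h h', max 1 (max (3 * C' / c) (3 * C / c')), by positivity, ?_⟩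
  rintro _ ⟨x, rfl⟩ _ ⟨y, rfl⟩
  rw [recode_apply h h', recode_apply h h', inv_mul_le_iff₀ (by positivity)]
  constructor
  · refine (h.dist_le_mul_dist h' x y).trans ?_
    gcongr
    exact (le_max_right _ _).trans (le_max_right _ _)
  · refine (h'.dist_le_mul_dist h x y).trans ?_
    gcongr
    exact (le_max_left _ _).trans (le_max_right _ _)

theorem continuousOn_recode (h : IsCoding Ψ C c) (h' : IsCoding Ψ' C' c') :
    ContinuousOn (recode Ψ Ψ') (range Ψ) :=
  (LipschitzOnWith.of_dist_le_mul (K := (3 * C' / c).toNNReal) fun z hz w hw =>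
    (dist_recode_le h h' z hz w hw).trans
      (mul_le_mul_of_nonneg_right (Real.le_coe_toNNReal _) dist_nonneg)).continuousOn

theorem preimage_recode_inter (h : IsCoding Ψ C c) (h' : IsCoding Ψ' C' c') (B : Set ℂ) :
    recode Ψ' Ψ ⁻¹' B ∩ range Ψ' = recode Ψ Ψ' '' (B ∩ range Ψ) := by
  ext z
  constructor
  · rintro ⟨hz, x, rfl⟩
    rw [mem_preimage, recode_apply h' h] at hz
    exact ⟨Ψ x, ⟨hz, x, rfl⟩, recode_apply h h' x⟩
  · rintro ⟨_, ⟨hz, x, rfl⟩, rfl⟩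
    rw [recode_apply h h']
    exact ⟨by rwa [mem_preimage, recode_apply h' h], x, rfl⟩

theorem measure_recode_mul_of_isClosed (h : IsCoding Ψ C c) (h' : IsCoding Ψ' C' c')
    (hu : IsUniform s Ψ) (hu' : IsUniform s Ψ') (hfin : μH[s] (range Ψ) ≠ ∞)
    (hfin' : μH[s] (range Ψ') ≠ ∞) {K : Set ℂ} (hK : IsClosed K) :
    μH[s] (range Ψ') * μH[s] (K ∩ range Ψ) =
      μH[s] (range Ψ) * μH[s] (recode Ψ Ψ' '' (K ∩ range Ψ)) := by
  have hK' : IsClosed (recode Ψ Ψ' '' (K ∩ range Ψ)) :=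
    ((h.isCompact_range.inter_left hK).image_of_continuousOn
      ((continuousOn_recode h h').mono inter_subset_right)).isClosed
  have hpre : Ψ' ⁻¹' (recode Ψ Ψ' '' (K ∩ range Ψ)) = Ψ ⁻¹' K := by
    ext x
    rw [mem_preimage, ← preimage_recode_inter h h', mem_inter_iff, mem_preimage,
      recode_apply h' h]
    exact and_iff_left (mem_range_self x)
  have h1 := ENNReal.Tendsto.const_mul (hu.tendsto_prefixes h hfin hK) (a := μH[s] (range Ψ'))
    (Or.inr hfin')
  have h2 := ENNReal.Tendsto.const_mul (hu'.tendsto_prefixes h' hfin' hK') (a := μH[s] (range Ψ))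
    (Or.inr hfin)
  rw [hpre, inter_eq_left.2 ((image_mono inter_subset_right).trans
    (bijOn_recode h h').image_eq.subset)] at h2
  refine tendsto_nhds_unique h1 (h2.congr fun n => ?_)
  ring

theorem measure_recode_mul (h : IsCoding Ψ C c) (h' : IsCoding Ψ' C' c')
    (hu : IsUniform s Ψ) (hu' : IsUniform s Ψ') (hfin : μH[s] (range Ψ) ≠ ∞)
    (hfin' : μH[s] (range Ψ') ≠ ∞) {B : Set ℂ} (hB : MeasurableSet B) (hBΨ : B ⊆ range Ψ) :
    μH[s] (range Ψ') * μH[s] B = μH[s] (range Ψ) * μH[s] (recode Ψ Ψ' '' B) := by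
  have hmeas : AEMeasurable (recode Ψ' Ψ) (μH[s].restrict (range Ψ')) :=
    (continuousOn_recode h' h).aemeasurable h'.isCompact_range.isClosed.measurableSet
  have happly : ∀ B : Set ℂ, MeasurableSet B →
      (μH[s].restrict (range Ψ')).map (recode Ψ' Ψ) B =
        μH[s] (recode Ψ Ψ' '' (B ∩ range Ψ)) := fun B hB => by
    rw [Measure.map_apply_of_aemeasurable hmeas hB, Measure.restrict_apply' 
      h'.isCompact_range.isClosed.measurableSet, preimage_recode_inter h h']
  have hclosed : ∀ K : Set ℂ, IsClosed K →
      (μH[s] (range Ψ') • μH[s].restrict (range Ψ)) K =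
        (μH[s] (range Ψ) • (μH[s].restrict (range Ψ')).map (recode Ψ' Ψ)) K := fun K hK => by
    rw [Measure.smul_apply, Measure.smul_apply, happly K hK.measurableSet,
      Measure.restrict_apply hK.measurableSet]
    exact measure_recode_mul_of_isClosed h h' hu hu' hfin hfin' hK
  have : IsFiniteMeasure (μH[s] (range Ψ') • (μH[s] : Measure ℂ).restrict (range Ψ)) := by
    refine ⟨?_⟩
    rw [Measure.smul_apply, Measure.restrict_apply_univ, smul_eq_mul]
    exact ENNReal.mul_lt_top hfin'.lt_top hfin.lt_top
  -- Two measures, one of them finite, agree on closed sets and on the whole plane, hence on all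
  -- Borel sets.
  have heq := ext_of_generate_finite _ (borel_eq_generateFrom_isClosed (α := ℂ) ▸
    BorelSpace.measurable_eq (α := ℂ)) isPiSystem_isClosed hclosed (hclosed _ isClosed_univ)
  have := congrArg (fun μ : Measure ℂ => μ B) heq
  simpa only [Measure.smul_apply, happly B hB, Measure.restrict_apply hB, inter_eq_left.2 hBΨ,
    smul_eq_mul] using this

end IsCoding

/-! ### Chains give uniform codings. -/

theorem hausdorffMeasure_image_add_div_three {s : ℝ} (hs0 : 0 < s) (hs : (3 : ℝ) ^ s = 5) (d : ℂ)
    (S : Set ℂ) : μH[s] ((fun w : ℂ => (w + d) / 3) '' S) = (5 : ℝ≥0∞)⁻¹ * μH[s] S := by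
  have h1 : (fun w : ℂ => (w + d) / 3) '' S
      = (fun w => w + d / 3) '' ((fun w => (3 : ℂ)⁻¹ • w) '' S) := by
    rw [image_image]
    refine image_congr fun w _ => ?_
    rw [smul_eq_mul]
    ring
  have h5 : ‖(3 : ℂ)⁻¹‖₊ ^ s = (5 : ℝ≥0)⁻¹ := by
    ext
    rw [NNReal.coe_rpow, coe_nnnorm, norm_inv, Complex.norm_ofNat, Real.inv_rpow (by norm_num), hs]
    simp
  have h2 : Isometry fun w : ℂ => w + d / 3 := (IsometryEquiv.addRight (d / 3)).isometry
  rw [h1, h2.hausdorffMeasure_image (Or.inl hs0.le),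
    image_smul, Measure.hausdorffMeasure_smul₀ hs0.le (by norm_num), h5, ENNReal.smul_def,
    smul_eq_mul, ENNReal.coe_inv (by norm_num), ENNReal.coe_ofNat]

namespace DigitTransducer.IsChain

variable {Q : Type*} {A : DigitTransducer Q} {B ε s : ℝ}

theorem isCoding (hA : A.IsChain B ε) (q : Q) :
    IsCoding (A.point q) (B + 1) (ε / (3 * B / 2 + 1)) where
  continuous := continuous_point hA.norm_digit_le q
  pos := div_pos hA.pos (by linarith [hA.bound_nonneg q])
  dist_le n x y h := (dist_eq_norm _ _).trans_le (hA.norm_sub_le_of_near q h)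
  le_dist n x y h := (hA.le_norm_sub_of_not_near q h).trans_eq (dist_eq_norm _ _).symm

theorem hausdorffMeasure_tile_le (hA : A.IsChain B ε) (hs0 : 0 < s) (hs : (3 : ℝ) ^ s = 5) (q : Q) :
    μH[s] (A.tile q) ≤ ∑ t, (5 : ℝ≥0∞)⁻¹ * μH[s] (A.tile (A.next q t)) := by
  have hsub : A.tile q ⊆
      ⋃ t ∈ Finset.univ, (fun w : ℂ => (w + A.digit q t) / 3) '' A.tile (A.next q t) := by
    intro z hz
    obtain ⟨t, w, hw, rfl⟩ := mem_tile_cases hA.norm_digit_le hz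
    exact mem_iUnion₂.2 ⟨t, Finset.mem_univ t, w, hw, rfl⟩
  refine (measure_mono hsub).trans ((measure_biUnion_finset_le _ _).trans_eq ?_)
  simp only [hausdorffMeasure_image_add_div_three hs0 hs]

/-- Maximum principle: by subadditivity and scaling, the measure of a tile is at most the average
over its five successors. -/
theorem hausdorffMeasure_tile_eq (hA : A.IsChain B ε) (hs0 : 0 < s) (hs : (3 : ℝ) ^ s = 5)
    (q q' : Q) : μH[s] (A.tile q) = μH[s] (A.tile q') := by
  have hfin : ∀ q, μH[s] (A.tile q) ≠ ∞ := fun q =>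
    ((hA.isCoding q).hausdorffMeasure_range_lt_top hs0 hs).ne
  refine (ENNReal.toReal_eq_toReal_iff' (hfin q) (hfin q')).1 ?_
  refine hA.eq_of_subharmonic (fun q => (μH[s] (A.tile q)).toReal) (fun q => ?_) q q'
  have hne : ∀ t ∈ Finset.univ, (5 : ℝ≥0∞)⁻¹ * μH[s] (A.tile (A.next q t)) ≠ ∞ := fun t _ =>
    ENNReal.mul_ne_top (by simp) (hfin _)
  have h1 := ENNReal.toReal_mono (ENNReal.sum_ne_top.2 hne) (hA.hausdorffMeasure_tile_le hs0 hs q)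
  rw [ENNReal.toReal_sum hne] at h1
  simp only [ENNReal.toReal_mul, ENNReal.toReal_inv, ENNReal.toReal_ofNat, ← Finset.mul_sum] at h1
  linarith

theorem isUniform (hA : A.IsChain B ε) (hs0 : 0 < s) (hs : (3 : ℝ) ^ s = 5) (q : Q) :
    IsCoding.IsUniform s (A.point q) := by
  intro n x
  induction n generalizing q x with
  | zero => simp [SamePrefix]
  | succ n ih =>
    have himage : A.point q '' {y | SamePrefix (n + 1) x y} =
        (fun w : ℂ => (w + A.digit q (x 0)) / 3) ''
          (A.point (A.next q (x 0)) '' {y | SamePrefix n (tailWord x) y}) := by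
      rw [image_image]
      ext z
      constructor
      · rintro ⟨y, hy, rfl⟩
        obtain ⟨h0, hy⟩ := samePrefix_succ.1 hy
        exact ⟨tailWord y, hy, by rw [point_eq hA.norm_digit_le q y, h0]⟩
      · rintro ⟨y, hy, rfl⟩
        refine ⟨consWord (x 0) y, samePrefix_succ.2 ⟨rfl, hy⟩, ?_⟩
        rw [point_eq hA.norm_digit_le, tailWord_consWord, consWord_zero]
    rw [himage, hausdorffMeasure_image_add_div_three hs0 hs, ih, ← mul_assoc, ← pow_succ']
    congr 1
    exact hA.hausdorffMeasure_tile_eq hs0 hs _ q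

theorem ofReal_image_Icc_subset_tile (hA : A.IsChain B ε) (q : Q) :
    Complex.ofReal '' Icc 0 1 ⊆ A.tile q := by
  refine subset_tile hA.norm_digit_le (S := fun _ => Complex.ofReal '' Icc 0 1) (R := 1) ?_ ?_ q
  · rintro q _ ⟨x, ⟨h0, h1⟩, rfl⟩
    rwa [Complex.norm_real, Real.norm_of_nonneg h0]
  · rintro q _ ⟨x, ⟨h0, h1⟩, rfl⟩
    rcases le_total x (1 / 3) with h2 | h2
    · refine ⟨0, _, ⟨3 * x, ⟨by linarith, by linarith⟩, rfl⟩, ?_⟩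
      rw [hA.digit_zero]
      push_cast
      ring
    · rcases le_total x (2 / 3) with h3 | h3
      · refine ⟨1, _, ⟨3 * x - 1, ⟨by linarith, by linarith⟩, rfl⟩, ?_⟩
        rw [hA.digit_one]
        push_cast
        ring
      · refine ⟨2, _, ⟨3 * x - 2, ⟨by linarith, by linarith⟩, rfl⟩, ?_⟩
        rw [hA.digit_two]
        push_cast
        ring

theorem not_isTotallyDisconnected_image_tile (hA : A.IsChain B ε) (q : Q) {g : ℂ → ℂ}
    (hg : Isometry g) : ¬ IsTotallyDisconnected (g '' A.tile q) := by
  intro h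
  have h1 := h (g '' (Complex.ofReal '' Icc 0 1)) (image_mono (hA.ofReal_image_Icc_subset_tile q))
    ((isPreconnected_Icc.image _ Complex.continuous_ofReal.continuousOn).image _
      hg.continuous.continuousOn)
  have h2 := h1 (mem_image_of_mem g (mem_image_of_mem _ (left_mem_Icc.2 zero_le_one)))
    (mem_image_of_mem g (mem_image_of_mem _ (right_mem_Icc.2 zero_le_one)))
  simpa using hg.injective h2

end DigitTransducer.IsChain

/-! ### The set F as a one-state chain. -/

theorem IsFractalSquare.mem_iff {D K : Set ℂ} (h : IsFractalSquare 3 D K) {z : ℂ} :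
    z ∈ K ↔ ∃ d ∈ D, 3 * z - d ∈ K := by
  conv_lhs => rw [h.isAttractor.eq_iUnion]
  simp only [mem_iUnion, mem_image, Subtype.exists, Nat.cast_ofNat]
  constructor
  · rintro ⟨d, hd, w, hw, rfl⟩
    exact ⟨d, hd, (show w = 3 * ((w + d) / 3) - d by ring) ▸ hw⟩
  · rintro ⟨d, hd, hz⟩
    exact ⟨d, hd, _, hz, by ring⟩

theorem le_norm_of_forall_not {ε : ℝ} {z : ℂ}
    (h : -ε < z.re → z.re < ε → -ε < z.im → z.im < ε → False) : ε ≤ ‖z‖ := by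
  by_contra! hlt
  have h1 := abs_lt.1 ((Complex.abs_re_le_norm z).trans_lt hlt)
  have h2 := abs_lt.1 ((Complex.abs_im_le_norm z).trans_lt hlt)
  exact h h1.1 h1.2 h2.1 h2.2

/-- The set `F`, rotated and translated so that the vertical chain of pieces becomes the unit
interval. -/
noncomputable def transducerF : DigitTransducer Unit where
  next _ _ := ()
  digit _ := ![0, 1, 2, 2 - Complex.I, 1 + Complex.I]

namespace transducerF

theorem norm_digit_le (q : Unit) (t : Fin 5) : ‖transducerF.digit q t‖ ≤ 3 := by
  refine (Complex.norm_le_abs_re_add_abs_im _).trans ?_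
  fin_cases t <;> norm_num [transducerF]

/-- The region is the quadrilateral with vertices 0, 1 - i/2, 1 and (1 + i)/2, which all five maps
send into itself. -/
theorem tile_bounds {z : ℂ} (hz : z ∈ transducerF.tile ()) :
    z.re ≤ 1 ∧ z.im ≤ z.re ∧ z.re + z.im ≤ 1 ∧ -z.re ≤ 2 * z.im := by
  suffices transducerF.tile () ⊆
      {z | z.re ≤ 1 ∧ z.im ≤ z.re ∧ z.re + z.im ≤ 1 ∧ -z.re ≤ 2 * z.im} from this hz
  refine DigitTransducer.tile_subset norm_digit_le
    (S := fun _ => {z | z.re ≤ 1 ∧ z.im ≤ z.re ∧ z.re + z.im ≤ 1 ∧ -z.re ≤ 2 * z.im}) (R := 0)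
    (fun _ => ⟨0, by norm_num, by simp⟩) (fun _ => ?_) (fun q t w hw => ?_) ()
  · have hre := Complex.continuous_re
    have him := Complex.continuous_im
    exact (isClosed_le hre continuous_const).inter <| (isClosed_le him hre).inter <|
      (isClosed_le (hre.add him) continuous_const).inter <|
      isClosed_le hre.neg (continuous_const.mul him)
  · obtain ⟨h1, h2, h3, h4⟩ := hw
    simp only [mem_ofPred_eq, Complex.div_ofNat_re, Complex.div_ofNat_im, Complex.add_re,
      Complex.add_im]
    fin_cases t <;> simp [transducerF] <;> refine ⟨?_, ?_, ?_, ?_⟩ <;> linarith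

theorem isChain : transducerF.IsChain 3 (1 / 10) where
  pos := by norm_num
  le_one := by norm_num
  norm_digit_le := norm_digit_le
  digit_zero _ := rfl
  digit_one _ := rfl
  digit_two _ := rfl
  digit_three_re _ := by simp [transducerF]
  digit_four_re _ := by simp [transducerF]
  separated q i j hij hadj z hz w hw := by
    obtain ⟨h1, h2, h3, h4⟩ := tile_bounds hz
    obtain ⟨h5, h6, h7, h8⟩ := tile_bounds hw
    refine le_norm_of_forall_not ?_
    simp only [Complex.sub_re, Complex.add_re, Complex.sub_im, Complex.add_im]
    fin_cases i <;> fin_cases j <;> first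
      | exact absurd hij (by decide)
      | (simp [transducerF]; intros; linarith)
      | exact absurd (by simp [Adjacent]) hadj
  separated_end q z hz := by
    obtain ⟨h1, h2, h3, h4⟩ := tile_bounds hz
    refine le_norm_of_forall_not ?_
    simp [transducerF]
    intros
    linarith
  eq_of_subharmonic h _ q q' := rfl

end transducerF

/-- The rigid motion that takes the rotated copy back to `F`. -/
noncomputable def motionF (z : ℂ) : ℂ := 1 / 2 + Complex.I - Complex.I * z

theorem isometry_motionF : Isometry motionF := Isometry.of_dist_eq fun z w => by
  rw [dist_eq_norm, dist_eq_norm, motionF, motionF, sub_sub_sub_cancel_left, ← mul_sub, norm_mul,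
    Complex.norm_I, one_mul, norm_sub_rev]

theorem eq_image_tile_F {F : Set ℂ} (hF : IsFractalSquare 3 digitsF F) :
    F = motionF '' transducerF.tile () := by
  have hcont : Continuous motionF := isometry_motionF.continuous
  have hsurj : Function.Surjective motionF := fun w =>
    ⟨Complex.I * (w - 1 / 2 - Complex.I), by
      rw [motionF, ← mul_assoc, Complex.I_mul_I]
      ring⟩
  -- Conjugation by the motion turns the digit d into i(d - 1 - 2i), which sends the digits of F, in
  -- the listed order, to those of `transducerF`.
  have hstep : ∀ z d w : ℂ, motionF w = 3 * motionF z - d →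
      z = (w + Complex.I * (d - 1 - 2 * Complex.I)) / 3 := fun z d w h => by
    simp only [motionF] at h
    linear_combination (-Complex.I / 3) * h + (z - w / 3) * Complex.I_sq
  obtain ⟨R, hR⟩ := hF.isAttractor.isCompact.isBounded.exists_norm_le
  obtain ⟨z₀, hz₀⟩ := hF.isAttractor.nonempty
  obtain ⟨w₀, rfl⟩ := hsurj z₀
  suffices motionF ⁻¹' F = transducerF.tile () by rw [← this, image_preimage_eq _ hsurj]
  apply subset_antisymm
  · refine DigitTransducer.subset_tile transducerF.norm_digit_le (S := fun _ => motionF ⁻¹' F)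
      (R := R + 2) (fun _ z hz => ?_) (fun q z hz => ?_) ()
    · have h1 := hR _ hz
      have h2 : ‖z‖ = ‖motionF z - (1 / 2 + Complex.I)‖ := by
        rw [motionF, sub_sub_cancel_left, norm_neg, norm_mul, Complex.norm_I, one_mul]
      have h3 : ‖(1 / 2 + Complex.I : ℂ)‖ ≤ 2 :=
        (norm_add_le _ _).trans (by norm_num)
      rw [h2]
      exact (norm_sub_le _ _).trans (add_le_add h1 h3)
    · obtain ⟨d, hd, hz⟩ := hF.mem_iff.1 hz
      obtain ⟨w, hw⟩ := hsurj (3 * motionF z - d)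
      rw [← hw] at hz
      have hzw := hstep z d w hw
      rcases hd with rfl | rfl | rfl | rfl | rfl
      · refine ⟨0, w, hz, hzw.trans ?_⟩
        simp [transducerF]
      · refine ⟨1, w, hz, hzw.trans ?_⟩
        simp [transducerF]
        linear_combination -Complex.I_sq
      · refine ⟨2, w, hz, hzw.trans ?_⟩
        simp [transducerF]
        linear_combination -2 * Complex.I_sq
      · refine ⟨3, w, hz, hzw.trans ?_⟩
        simp [transducerF]
        linear_combination -2 * Complex.I_sq
      · refine ⟨4, w, hz, hzw.trans ?_⟩
        simp [transducerF]
        linear_combination -Complex.I_sq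
  · refine DigitTransducer.tile_subset transducerF.norm_digit_le (S := fun _ => motionF ⁻¹' F)
      (R := ‖w₀‖) (fun _ => ⟨w₀, hz₀, le_rfl⟩)
      (fun _ => hF.isAttractor.isCompact.isClosed.preimage hcont) (fun q t w hw => ?_) ()
    rw [mem_preimage, hF.mem_iff]
    refine ⟨3 * motionF ((w + transducerF.digit q t) / 3) - motionF w, ?_, by rwa [sub_sub_cancel]⟩
    simp only [motionF, digitsF, mem_insert_iff, mem_singleton_iff]
    fin_cases t <;> simp [transducerF]
    · left; ring
    · right; left; ring
    · right; right; left; ring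
    · right; right; right; left; linear_combination Complex.I_sq
    · right; right; right; right; linear_combination -Complex.I_sq

/-! ### The recoding of E and the separation of its pieces. -/

/-- The shapes of the pieces of `E` in the recoding that undoes the contact between the pieces with
digits `2` and `2 + i`. Write `K` for the corner piece of `E`, with digit `1 + 2i`, and `KK` for the
corner piece of `K`. -/
inductive PieceShape
  /-- the set `E` -/
  | whole
  /-- the set `E` with `KK` moved up by `1` -/
  | raised
  /-- the set `E` with `K` moved up by `3` -/
  | raisedCorner
  /-- the set `E` with `KK` moved down by `1` -/
  | lowered
  /-- the set `E` with `K` moved down by `3`, except for `KK`, which is moved down by `2` -/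
  | loweredCorner

open PieceShape in
/-- The recoding of `E`. -/
noncomputable def transducerE : DigitTransducer PieceShape where
  next
    | whole => ![whole, whole, raised, lowered, whole]
    | raised => ![whole, whole, raised, lowered, raisedCorner]
    | raisedCorner => ![whole, whole, raised, lowered, whole]
    | lowered => ![whole, lowered, raised, lowered, loweredCorner]
    | loweredCorner => ![whole, whole, raised, lowered, raisedCorner]
  digit
    | raisedCorner => ![0, 1, 2, 2 + Complex.I, 1 + 2 * Complex.I + 9 * Complex.I]
    | loweredCorner => ![0, 1, 2, 2 + Complex.I, 1 + 2 * Complex.I - 9 * Complex.I]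
    | _ => ![0, 1, 2, 2 + Complex.I, 1 + 2 * Complex.I]

namespace transducerE

open PieceShape Complex

theorem norm_digit_le (q : PieceShape) (t : Fin 5) : ‖transducerE.digit q t‖ ≤ 12 := by
  refine (Complex.norm_le_abs_re_add_abs_im _).trans ?_
  cases q <;> fin_cases t <;> norm_num [transducerE, abs_le]

/-- A convex octagon. -/
def octagon (l u a b c d : ℝ) : Set ℂ :=
  {z | (0 ≤ z.re ∧ z.re ≤ 1) ∧ (l ≤ z.im ∧ z.im ≤ u) ∧ (a ≤ z.re + z.im ∧ z.re + z.im ≤ b) ∧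
    2 * z.re - z.im ≤ c ∧ z.im - 2 * z.re ≤ d}

theorem isClosed_octagon (l u a b c d : ℝ) : IsClosed (octagon l u a b c d) := by
  have hre := Complex.continuous_re
  have him := Complex.continuous_im
  have h2 : Continuous fun z : ℂ => 2 * z.re := continuous_const.mul hre
  exact ((isClosed_le continuous_const hre).inter (isClosed_le hre continuous_const)).inter <|
    ((isClosed_le continuous_const him).inter (isClosed_le him continuous_const)).inter <|
    ((isClosed_le continuous_const (hre.add him)).inter
      (isClosed_le (hre.add him) continuous_const)).inter <|
    (isClosed_le (h2.sub him) continuous_const).inter (isClosed_le (him.sub h2) continuous_const)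

/-- An octagon that contains the piece. -/
def hull : PieceShape → Set ℂ
  | whole => octagon 0 1 0 (3 / 2) 2 0
  | raised => octagon 0 2 0 (5 / 2) 2 1
  | raisedCorner => octagon 0 4 0 (9 / 2) 2 3
  | lowered => octagon (-1 / 9) (8 / 9) 0 (3 / 2) 2 0
  | loweredCorner => octagon (-7 / 3) (2 / 3) (-2) (3 / 2) (11 / 3) 0

theorem tile_subset_hull (q : PieceShape) : transducerE.tile q ⊆ hull q := by
  refine DigitTransducer.tile_subset norm_digit_le (S := hull) (R := 0)
    (fun q => ⟨0, ?_, by simp⟩) (fun q => ?_) (fun q t w hw => ?_) q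
  · cases q <;> norm_num [hull, octagon]
  · cases q <;> exact isClosed_octagon _ _ _ _ _ _
  · cases q <;> fin_cases t <;>
      (obtain ⟨⟨h1, h2⟩, ⟨h3, h4⟩, ⟨h5, h6⟩, h7, h8⟩ := hw
       simp only [hull, octagon, mem_ofPred_eq, Complex.div_ofNat_re, Complex.div_ofNat_im,
        Complex.add_re, Complex.add_im]
       simp [transducerE]
       refine ⟨⟨?_, ?_⟩, ⟨?_, ?_⟩, ⟨?_, ?_⟩, ?_, ?_⟩ <;> linarith)

/-- The extra vertical displacement of the last piece. -/
def shift : PieceShape → ℝ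
  | raisedCorner => 9
  | loweredCorner => -9
  | _ => 0

theorem tile_cases {q : PieceShape} {z : ℂ} (hz : z ∈ transducerE.tile q) :
    (∃ w ∈ transducerE.tile whole, 3 * z.re = w.re ∧ 3 * z.im = w.im) ∨
    (∃ w ∈ transducerE.tile (transducerE.next q 1), 3 * z.re = w.re + 1 ∧ 3 * z.im = w.im) ∨
    (∃ w ∈ transducerE.tile raised, 3 * z.re = w.re + 2 ∧ 3 * z.im = w.im) ∨
    (∃ w ∈ transducerE.tile lowered, 3 * z.re = w.re + 2 ∧ 3 * z.im = w.im + 1) ∨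
    ∃ w ∈ transducerE.tile (transducerE.next q 4),
      3 * z.re = w.re + 1 ∧ 3 * z.im = w.im + (2 + shift q) := by
  obtain ⟨t, w, hw, rfl⟩ := DigitTransducer.mem_tile_cases norm_digit_le hz
  simp only [Complex.div_ofNat_re, Complex.div_ofNat_im, Complex.add_re, Complex.add_im,
    mul_div_cancel₀ _ (three_ne_zero : (3 : ℝ) ≠ 0)]
  fin_cases t
  · refine Or.inl ⟨w, ?_, ?_⟩
    · cases q <;> exact hw
    · cases q <;> simp [transducerE]
  · refine Or.inr (Or.inl ⟨w, hw, ?_⟩)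
    cases q <;> simp [transducerE]
  · refine Or.inr (Or.inr (Or.inl ⟨w, ?_, ?_⟩))
    · cases q <;> exact hw
    · cases q <;> simp [transducerE]
  · refine Or.inr (Or.inr (Or.inr (Or.inl ⟨w, ?_, ?_⟩)))
    · cases q <;> exact hw
    · cases q <;> simp [transducerE]
  · refine Or.inr (Or.inr (Or.inr (Or.inr ⟨w, hw, ?_⟩)))
    cases q <;> norm_num [transducerE, shift]

/-- The former contact of the pieces 2 and 2 + i, after the exchange. The raised KK fills the hole
left by the lowered one, so the hulls overlap and pieces must be subdivided until octagons suffice.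
-/
theorem separated_raised_lowered {z w : ℂ} (hz : z ∈ transducerE.tile raised)
    (hw : w ∈ transducerE.tile lowered) : 1 / 100 ≤ ‖z - (w + I)‖ := by
  refine le_norm_of_forall_not ?_
  simp only [Complex.sub_re, Complex.add_re, Complex.sub_im, Complex.add_im, Complex.I_re,
    Complex.I_im]
  intro h1 h2 h3 h4
  have hwh : w ∈ octagon _ _ _ _ _ _ := tile_subset_hull _ hw
  obtain ⟨⟨w1, w2⟩, ⟨w3, w4⟩, ⟨w5, w6⟩, w7, w8⟩ := hwh
  rcases tile_cases hz with ⟨u, hu, hu1, hu2⟩ | ⟨u, hu, hu1, hu2⟩ | ⟨u, hu, hu1, hu2⟩ |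
    ⟨u, hu, hu1, hu2⟩ | ⟨u, hu, hu1, hu2⟩ <;> (try simp only [shift] at hu2)
  · have huh : u ∈ octagon _ _ _ _ _ _ := tile_subset_hull _ hu
    obtain ⟨-, ⟨u3, u4⟩, -⟩ := huh
    linarith
  · have huh : u ∈ octagon _ _ _ _ _ _ := tile_subset_hull _ hu
    obtain ⟨-, ⟨u3, u4⟩, -⟩ := huh
    linarith
  · have huh : u ∈ octagon _ _ _ _ _ _ := tile_subset_hull _ hu
    obtain ⟨-, ⟨u3, u4⟩, -⟩ := huh
    linarith
  · have huh : u ∈ octagon _ _ _ _ _ _ := tile_subset_hull _ hu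
    obtain ⟨-, ⟨u3, u4⟩, -⟩ := huh
    linarith
  rcases tile_cases (q := raisedCorner) hu with ⟨v, hv, hv1, hv2⟩ | ⟨v, hv, hv1, hv2⟩ | ⟨v, hv, hv1, hv2⟩ |
    ⟨v, hv, hv1, hv2⟩ | ⟨v, hv, hv1, hv2⟩ <;> (try simp only [shift] at hv2)
  · have hvh : v ∈ octagon _ _ _ _ _ _ := tile_subset_hull _ hv
    obtain ⟨-, ⟨v3, v4⟩, -⟩ := hvh
    linarith
  · have hvh : v ∈ octagon _ _ _ _ _ _ := tile_subset_hull _ hv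
    obtain ⟨-, ⟨v3, v4⟩, -⟩ := hvh
    linarith
  · have hvh : v ∈ octagon _ _ _ _ _ _ := tile_subset_hull _ hv
    obtain ⟨⟨v1, v2⟩, ⟨v3, v4⟩, ⟨v5, v6⟩, v7, v8⟩ := hvh
    rcases tile_cases hw with ⟨y, hy, hy1, hy2⟩ | ⟨y, hy, hy1, hy2⟩ | ⟨y, hy, hy1, hy2⟩ |
      ⟨y, hy, hy1, hy2⟩ | ⟨y, hy, hy1, hy2⟩ <;> (try simp only [shift] at hy2) <;>
    · have hyh : y ∈ octagon _ _ _ _ _ _ := tile_subset_hull _ hy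
      obtain ⟨⟨y1, y2⟩, ⟨y3, y4⟩, ⟨y5, y6⟩, y7, y8⟩ := hyh
      linarith
  -- The heights are at most 71/81 for z and at least 72/81 for w + i: a gap of only 1/81.
  · have hvh : v ∈ octagon _ _ _ _ _ _ := tile_subset_hull _ hv
    obtain ⟨-, ⟨v3, v4⟩, -⟩ := hvh
    linarith
  · have hvh : v ∈ octagon _ _ _ _ _ _ := tile_subset_hull _ hv
    obtain ⟨⟨v1, v2⟩, ⟨v3, v4⟩, ⟨v5, v6⟩, v7, v8⟩ := hvh
    rcases tile_cases hw with ⟨y, hy, hy1, hy2⟩ | ⟨y, hy, hy1, hy2⟩ | ⟨y, hy, hy1, hy2⟩ |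
      ⟨y, hy, hy1, hy2⟩ | ⟨y, hy, hy1, hy2⟩ <;> (try simp only [shift] at hy2)
    iterate 4
      · have hyh : y ∈ octagon _ _ _ _ _ _ := tile_subset_hull _ hy
        obtain ⟨⟨y1, y2⟩, ⟨y3, y4⟩, ⟨y5, y6⟩, y7, y8⟩ := hyh
        linarith
    rcases tile_cases (q := loweredCorner) hy with ⟨x, hx, hx1, hx2⟩ | ⟨x, hx, hx1, hx2⟩ | ⟨x, hx, hx1, hx2⟩ |
      ⟨x, hx, hx1, hx2⟩ | ⟨x, hx, hx1, hx2⟩ <;> (try simp only [shift] at hx2) <;>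
    · have hxh : x ∈ octagon _ _ _ _ _ _ := tile_subset_hull _ hx
      obtain ⟨⟨x1, x2⟩, ⟨x3, x4⟩, ⟨x5, x6⟩, x7, x8⟩ := hxh
      linarith

end transducerE

namespace transducerE

open PieceShape Complex

theorem separated_lowered_loweredCorner {z w : ℂ} (hz : z ∈ transducerE.tile lowered)
    (hw : w ∈ transducerE.tile loweredCorner) : 1 / 100 ≤ ‖z + 1 - (w + (1 + 2 * I))‖ := by
  have hzh : z ∈ octagon _ _ _ _ _ _ := tile_subset_hull _ hz
  obtain ⟨⟨z1, z2⟩, ⟨z3, z4⟩, ⟨z5, z6⟩, z7, z8⟩ := hzh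
  obtain ⟨t, v, hv, rfl⟩ := DigitTransducer.mem_tile_cases norm_digit_le hw
  by_cases ht : t = 4
  -- The last piece of `loweredCorner` is that of `raised` moved down by 3, so this contact is a
  -- translate of the one between `raised` and `lowered`.
  · subst ht
    have h1 : (v + (1 + 2 * I)) / 3 ∈ transducerE.tile raised :=
      DigitTransducer.mem_tile_of_mem_next norm_digit_le (q := raised) (t := 4) hv
    have h2 := separated_raised_lowered h1 hz
    have h3 : z + 1 - ((v + transducerE.digit loweredCorner 4) / 3 + (1 + 2 * I)) =
        z + I - (v + (1 + 2 * I)) / 3 := by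
      simp only [transducerE, Matrix.cons_val]
      ring
    rwa [h3, norm_sub_rev]
  · have hvh := tile_subset_hull _ hv
    refine le_norm_of_forall_not ?_
    fin_cases t <;> first
      | exact absurd rfl ht
      | (simp [transducerE, hull, octagon] at hvh ⊢; intros; linarith)

theorem separated_loweredCorner {z w : ℂ} {q : PieceShape} {t : Fin 5}
    (hqt : (q = whole ∧ t = 0) ∨ (q = raised ∧ t = 2) ∨ (q = lowered ∧ t = 3))
    (hz : z ∈ transducerE.tile q) (hw : w ∈ transducerE.tile loweredCorner) :
    1 / 100 ≤ ‖z + transducerE.digit lowered t - (w + (1 + 2 * I))‖ := by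
  have hzh := tile_subset_hull _ hz
  obtain ⟨t', v, hv, rfl⟩ := DigitTransducer.mem_tile_cases norm_digit_le hw
  have hvh := tile_subset_hull _ hv
  refine le_norm_of_forall_not ?_
  rcases hqt with ⟨rfl, rfl⟩ | ⟨rfl, rfl⟩ | ⟨rfl, rfl⟩ <;> fin_cases t' <;>
    (simp [transducerE, hull, octagon] at hvh hzh ⊢; intros; linarith)

set_option maxHeartbeats 1000000 in
theorem separated (q : PieceShape) (i j : Fin 5) (hij : i < j) (hadj : ¬ Adjacent i j) (z : ℂ)
    (hz : z ∈ transducerE.tile (transducerE.next q i)) (w : ℂ)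
    (hw : w ∈ transducerE.tile (transducerE.next q j)) :
    1 / 100 ≤ ‖z + transducerE.digit q i - (w + transducerE.digit q j)‖ := by
  by_cases h23 : i = 2 ∧ j = 3
  · obtain ⟨rfl, rfl⟩ := h23
    have h1 : z ∈ transducerE.tile raised := by cases q <;> exact hz
    have h2 : w ∈ transducerE.tile lowered := by cases q <;> exact hw
    have h3 : z + transducerE.digit q 2 - (w + transducerE.digit q 3) = z - (w + I) := by
      cases q <;> simp only [transducerE, Matrix.cons_val] <;> ring
    rw [h3]
    exact separated_raised_lowered h1 h2
  by_cases hlow : q = lowered ∧ j = 4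
  · obtain ⟨rfl, rfl⟩ := hlow
    fin_cases i
    · exact separated_loweredCorner (Or.inl ⟨rfl, rfl⟩) hz hw
    · exact separated_lowered_loweredCorner hz hw
    · exact separated_loweredCorner (Or.inr (Or.inl ⟨rfl, rfl⟩)) hz hw
    · exact separated_loweredCorner (Or.inr (Or.inr ⟨rfl, rfl⟩)) hz hw
    · exact absurd hij (by decide)
  have hzh := tile_subset_hull _ hz
  have hwh := tile_subset_hull _ hw
  have hcases : (i = 0 ∧ j = 2) ∨ (i = 0 ∧ j = 3) ∨ (i = 0 ∧ j = 4) ∨ (i = 1 ∧ j = 3) ∨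
      (i = 1 ∧ j = 4) ∨ (i = 2 ∧ j = 4) ∨ (i = 3 ∧ j = 4) := by
    unfold Adjacent at hadj
    clear hlow hz hw hzh hwh
    revert i j
    decide
  refine le_norm_of_forall_not ?_
  rcases hcases with ⟨rfl, rfl⟩ | ⟨rfl, rfl⟩ | ⟨rfl, rfl⟩ | ⟨rfl, rfl⟩ | ⟨rfl, rfl⟩ | ⟨rfl, rfl⟩ |
    ⟨rfl, rfl⟩ <;> cases q <;> first
      | exact absurd ⟨rfl, rfl⟩ hlow
      | (simp [transducerE, hull, octagon] at hzh hwh ⊢; intros; linarith)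

theorem isChain : transducerE.IsChain 12 (1 / 100) where
  pos := by norm_num
  le_one := by norm_num
  norm_digit_le := norm_digit_le
  digit_zero q := by cases q <;> rfl
  digit_one q := by cases q <;> rfl
  digit_two q := by cases q <;> rfl
  digit_three_re q := by cases q <;> simp [transducerE]
  digit_four_re q := by cases q <;> simp [transducerE]
  separated := separated
  separated_end q z hz := by
    have h : z ∈ transducerE.tile lowered := by cases q <;> exact hz
    have hzh : z ∈ octagon _ _ _ _ _ _ := tile_subset_hull _ h
    obtain ⟨-, ⟨h3, h4⟩, -⟩ := hzh
    refine le_norm_of_forall_not ?_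
    cases q <;> simp [transducerE] <;> intros <;> linarith
  eq_of_subharmonic h hh := by
    have h1 := hh whole
    have h2 := hh raised
    have h3 := hh raisedCorner
    have h4 := hh lowered
    have h5 := hh loweredCorner
    simp [transducerE, Fin.sum_univ_five] at h1 h2 h3 h4 h5
    -- Maximum principle on a strongly connected graph: every state leads to `whole`, and `whole`
    -- leads to every state.
    have e : ∀ q, h q = h whole := fun q => by cases q <;> linarith
    exact fun q q' => (e q).trans (e q').symm

end transducerE

/-! ### The five shapes realized inside translates of parts of E. -/

/-- The part of a fractal square with the digits of `E` outside the corner piece. -/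
def baseE (E : Set ℂ) : Set ℂ :=
  {z | 3 * z ∈ E ∨ 3 * z - 1 ∈ E ∨ 3 * z - 2 ∈ E ∨ 3 * z - (2 + Complex.I) ∈ E}

open Complex in
/-- The sets described in `PieceShape`. -/
def shapeSet (E : Set ℂ) : PieceShape → Set ℂ
  | .whole => E
  | .raised => {z | z ∈ baseE E ∨ 3 * z - (1 + 2 * I) ∈ baseE E ∨ 9 * (z - I) - 4 * (1 + 2 * I) ∈ E}
  | .raisedCorner => {z | z ∈ baseE E ∨ 3 * z - (1 + 2 * I) - 9 * I ∈ E}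
  | .lowered => {z | z ∈ baseE E ∨ 3 * z - (1 + 2 * I) ∈ baseE E ∨
      9 * (z + I) - 4 * (1 + 2 * I) ∈ E}
  | .loweredCorner => {z | z ∈ baseE E ∨ 3 * (z + 3 * I) - (1 + 2 * I) ∈ baseE E ∨
      9 * (z + 2 * I) - 4 * (1 + 2 * I) ∈ E}

section ShapesOfE

open PieceShape Complex

variable {E : Set ℂ}

theorem mem_E_iff (hE : IsFractalSquare 3 digitsE E) {z : ℂ} :
    z ∈ E ↔ z ∈ baseE E ∨ 3 * z - (1 + 2 * I) ∈ E := by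
  rw [hE.mem_iff]
  simp only [digitsE, mem_insert_iff, mem_singleton_iff, exists_eq_or_imp, exists_eq_left, baseE,
    mem_ofPred_eq, sub_zero]
  tauto

theorem mem_E_cases (hE : IsFractalSquare 3 digitsE E) {z : ℂ} (hz : z ∈ E) :
    z ∈ baseE E ∨ 3 * z - (1 + 2 * I) ∈ baseE E ∨ 9 * z - 4 * (1 + 2 * I) ∈ E := by
  refine ((mem_E_iff hE).1 hz).imp_right fun h => ((mem_E_iff hE).1 h).imp_right fun h => ?_
  convert h using 1
  ring

theorem mem_E_of_corner (hE : IsFractalSquare 3 digitsE E) {z : ℂ}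
    (hz : 9 * z - 4 * (1 + 2 * I) ∈ E) : z ∈ E := by
  refine (mem_E_iff hE).2 (Or.inr ((mem_E_iff hE).2 (Or.inr ?_)))
  convert hz using 1
  ring

theorem mem_of_eq {S : Set ℂ} {z w : ℂ} (hz : z ∈ S) (h : w = z) : w ∈ S := h ▸ hz

theorem baseE_subset (hE : IsFractalSquare 3 digitsE E) : baseE E ⊆ E := fun _ h =>
  (mem_E_iff hE).2 (Or.inl h)

theorem baseE_subset_shapeSet (hE : IsFractalSquare 3 digitsE E) (q : PieceShape) :
    baseE E ⊆ shapeSet E q := fun z hz => by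
  cases q
  · exact baseE_subset hE hz
  all_goals exact Or.inl hz

theorem exists_shapeSet_of_baseE (hE : IsFractalSquare 3 digitsE E) (q : PieceShape) {z : ℂ}
    (hz : z ∈ baseE E) : ∃ t, 3 * z - transducerE.digit q t ∈ shapeSet E (transducerE.next q t) := by
  rcases hz with h | h | h | h
  · refine ⟨0, ?_⟩
    cases q <;> exact mem_of_eq h (by simp [transducerE])
  · by_cases hq : q = lowered
    · subst hq
      rcases mem_E_cases hE h with h | h | h
      · exact ⟨1, Or.inl h⟩
      · exact ⟨1, Or.inr (Or.inl h)⟩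
      -- In `lowered`, the KK part of the middle piece is handed over to the last letter.
      · refine ⟨4, Or.inr (Or.inr (mem_of_eq h ?_))⟩
        simp only [transducerE, Matrix.cons_val]
        ring
    · refine ⟨1, ?_⟩
      cases q
      case lowered => exact absurd rfl hq
      all_goals exact h
  · have h3 : ∀ q, transducerE.next q 3 = lowered := fun q => by cases q <;> rfl
    have h2 : ∀ q, transducerE.next q 2 = raised := fun q => by cases q <;> rfl
    rcases mem_E_cases hE h with h | h | h
    · refine ⟨2, ?_⟩
      rw [h2, transducerE.isChain.digit_two]
      exact Or.inl h
    · refine ⟨2, ?_⟩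
      rw [h2, transducerE.isChain.digit_two]
      exact Or.inr (Or.inl h)
    -- The exchange itself: the KK part of piece 2 is read with the letter 3, and below that of
    -- piece 2 + i with the letter 2.
    · refine ⟨3, ?_⟩
      rw [h3]
      refine Or.inr (Or.inr (mem_of_eq h ?_))
      cases q <;> simp only [transducerE, Matrix.cons_val] <;> ring
  · have h3 : ∀ q, transducerE.next q 3 = lowered := fun q => by cases q <;> rfl
    have h2 : ∀ q, transducerE.next q 2 = raised := fun q => by cases q <;> rfl
    have hd : transducerE.digit q 3 = 2 + I := by cases q <;> rfl
    rcases mem_E_cases hE h with h | h | h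
    · refine ⟨3, ?_⟩
      rw [h3, hd]
      exact Or.inl h
    · refine ⟨3, ?_⟩
      rw [h3, hd]
      exact Or.inr (Or.inl h)
    · refine ⟨2, ?_⟩
      rw [h2, transducerE.isChain.digit_two]
      refine Or.inr (Or.inr (mem_of_eq h ?_))
      ring

theorem exists_shapeSet_of_mem (hE : IsFractalSquare 3 digitsE E) (q : PieceShape) {z : ℂ}
    (hz : z ∈ shapeSet E q) :
    ∃ t, 3 * z - transducerE.digit q t ∈ shapeSet E (transducerE.next q t) := by
  by_cases hb : z ∈ baseE E
  · exact exists_shapeSet_of_baseE hE q hb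
  cases q
  · exact ⟨4, ((mem_E_iff hE).1 hz).resolve_left hb⟩
  · rcases hz.resolve_left hb with h | h
    · exact ⟨4, Or.inl h⟩
    · refine ⟨4, Or.inr (mem_of_eq h ?_)⟩
      simp only [transducerE, Matrix.cons_val]
      ring
  · refine ⟨4, mem_of_eq (hz.resolve_left hb) ?_⟩
    simp only [transducerE, Matrix.cons_val]
    ring
  · rcases hz.resolve_left hb with h | h
    · exact ⟨4, Or.inl h⟩
    · rcases (mem_E_iff hE).1 h with h | h
      · refine ⟨4, Or.inr (Or.inl (mem_of_eq h ?_))⟩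
        simp only [transducerE, Matrix.cons_val]
        ring
      -- In return, the middle piece receives the corner of the lowered KK.
      · refine ⟨1, Or.inr (Or.inr (mem_of_eq h ?_))⟩
        simp only [transducerE, Matrix.cons_val]
        ring
  · rcases hz.resolve_left hb with h | h
    · refine ⟨4, Or.inl (mem_of_eq h ?_)⟩
      simp only [transducerE, Matrix.cons_val]
      ring
    · refine ⟨4, Or.inr (mem_of_eq h ?_)⟩
      simp only [transducerE, Matrix.cons_val]
      ring

theorem mem_E_of_raised (hE : IsFractalSquare 3 digitsE E) {w : ℂ} (hw : w ∈ shapeSet E raised) :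
    w ∈ E ∨ w - I ∈ E := by
  rcases hw with h | h | h
  · exact Or.inl (baseE_subset hE h)
  · exact Or.inl ((mem_E_iff hE).2 (Or.inr (baseE_subset hE h)))
  · exact Or.inr (mem_E_of_corner hE h)

theorem mem_E_of_lowered (hE : IsFractalSquare 3 digitsE E) {w : ℂ} (hw : w ∈ shapeSet E lowered) :
    w ∈ E ∨ w + I ∈ E := by
  rcases hw with h | h | h
  · exact Or.inl (baseE_subset hE h)
  · exact Or.inl ((mem_E_iff hE).2 (Or.inr (baseE_subset hE h)))
  · exact Or.inr (mem_E_of_corner hE h)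

theorem mem_baseE_of_raised (hE : IsFractalSquare 3 digitsE E) {w z : ℂ}
    (hw : w ∈ shapeSet E raised) (hz : 3 * z - 2 = w) : z ∈ baseE E := by
  rcases mem_E_of_raised hE hw with h | h
  · exact Or.inr (Or.inr (Or.inl (mem_of_eq h hz)))
  · exact Or.inr (Or.inr (Or.inr (mem_of_eq h (by rw [← hz]; ring))))

theorem mem_baseE_of_lowered (hE : IsFractalSquare 3 digitsE E) {w z : ℂ}
    (hw : w ∈ shapeSet E lowered) (hz : 3 * z - (2 + I) = w) : z ∈ baseE E := by
  rcases mem_E_of_lowered hE hw with h | h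
  · exact Or.inr (Or.inr (Or.inr (mem_of_eq h hz)))
  · exact Or.inr (Or.inr (Or.inl (mem_of_eq h (by rw [← hz]; ring))))

theorem shapeSet_of_mem_next (hE : IsFractalSquare 3 digitsE E) (q : PieceShape) (t : Fin 5) {z w : ℂ}
    (hw : w ∈ shapeSet E (transducerE.next q t)) (hz : 3 * z = w + transducerE.digit q t) :
    z ∈ shapeSet E q := by
  fin_cases t
  · refine baseE_subset_shapeSet hE q (Or.inl ?_)
    have hw' : w ∈ E := by cases q <;> exact hw
    refine mem_of_eq hw' (hz.trans ?_)
    cases q <;> exact add_zero w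
  · have hz' : 3 * z - 1 = w := by
      rw [hz, sub_eq_iff_eq_add]
      cases q <;> rfl
    by_cases hq : q = lowered
    · subst hq
      rcases hw with h | h | h
      · exact Or.inl (Or.inr (Or.inl (mem_of_eq (baseE_subset hE h) hz')))
      · exact Or.inl (Or.inr (Or.inl
          (mem_of_eq ((mem_E_iff hE).2 (Or.inr (baseE_subset hE h))) hz')))
      · refine Or.inr (Or.inr ((mem_E_iff hE).2 (Or.inr (mem_of_eq h ?_))))
        rw [← hz']
        ring
    · refine baseE_subset_shapeSet hE q (Or.inr (Or.inl ?_))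
      have hw' : w ∈ E := by
        cases q
        case lowered => exact absurd rfl hq
        all_goals exact hw
      exact mem_of_eq hw' hz'
  · refine baseE_subset_shapeSet hE q (mem_baseE_of_raised hE (w := w) ?_ ?_)
    · cases q <;> exact hw
    · rw [hz, sub_eq_iff_eq_add]
      cases q <;> rfl
  · refine baseE_subset_shapeSet hE q (mem_baseE_of_lowered hE (w := w) ?_ ?_)
    · cases q <;> exact hw
    · rw [hz, sub_eq_iff_eq_add]
      cases q <;> rfl
  · have hz' : w = 3 * z - transducerE.digit q 4 := eq_sub_of_add_eq hz.symm
    subst hz'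
    clear hz
    cases q <;> simp only [transducerE, Matrix.cons_val] at hw
    · exact (mem_E_iff hE).2 (Or.inr hw)
    · rcases hw with h | h
      · exact Or.inr (Or.inl h)
      · exact Or.inr (Or.inr (mem_of_eq h (by ring)))
    · exact Or.inr (mem_of_eq hw (by ring))
    · rcases hw with h | h | h
      · exact Or.inr (Or.inl h)
      · exact Or.inr (Or.inr (baseE_subset hE (mem_of_eq h (by ring))))
      · refine Or.inl (Or.inr (Or.inl (mem_E_of_corner hE (mem_of_eq h (by ring)))))
    · rcases hw with h | h
      · exact Or.inr (Or.inl (mem_of_eq h (by ring)))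
      · exact Or.inr (Or.inr (mem_of_eq h (by ring)))

theorem isClosed_baseE (hE : IsClosed E) : IsClosed (baseE E) :=
  (hE.preimage (by fun_prop)).union <| (hE.preimage (by fun_prop)).union <|
    (hE.preimage (by fun_prop)).union (hE.preimage (by fun_prop))

theorem isClosed_shapeSet (hE : IsClosed E) (q : PieceShape) : IsClosed (shapeSet E q) := by
  have hb := isClosed_baseE hE
  cases q
  · exact hE
  · exact hb.union <| (hb.preimage (by fun_prop)).union (hE.preimage (by fun_prop))
  · exact hb.union (hE.preimage (by fun_prop))
  · exact hb.union <| (hb.preimage (by fun_prop)).union (hE.preimage (by fun_prop))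
  · exact hb.union <| (hb.preimage (by fun_prop)).union (hE.preimage (by fun_prop))

theorem norm_le_of_mem_baseE {R : ℝ} (hR : ∀ z ∈ E, ‖z‖ ≤ R) {z : ℂ} (hz : z ∈ baseE E) :
    ‖z‖ ≤ R + 3 := by
  have key : ∀ d : ℂ, ‖d‖ ≤ 3 → 3 * z - d ∈ E → ‖z‖ ≤ R + 3 := fun d hd h => by
    have h1 := norm_add_le (3 * z - d) d
    rw [sub_add_cancel, norm_mul, Complex.norm_ofNat] at h1
    linarith [hR _ h, norm_nonneg z]
  rcases hz with h | h | h | h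
  · exact key 0 (by simp) (by simpa using h)
  · exact key 1 (by simp) h
  · exact key 2 (by norm_num) h
  · exact key (2 + I) ((norm_add_le _ _).trans (by norm_num)) h

theorem norm_le_of_mem_shapeSet {R : ℝ} (hR : ∀ z ∈ E, ‖z‖ ≤ R) (q : PieceShape) {z : ℂ}
    (hz : z ∈ shapeSet E q) : ‖z‖ ≤ R + 50 := by
  have key : ∀ (a : ℝ) (d w : ℂ), 1 ≤ a → ‖d‖ ≤ 47 → ‖w‖ ≤ R + 3 → a * z - d = w → ‖z‖ ≤ R + 50 := by
    intro a d w ha hd hw h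
    have h1 := norm_add_le w d
    rw [← h, sub_add_cancel, norm_mul, Complex.norm_real, Real.norm_of_nonneg (by linarith),
      h] at h1
    nlinarith [norm_nonneg z]
  have hI : ∀ x y : ℝ, |x| + |y| ≤ 47 → ‖(x + y * I : ℂ)‖ ≤ 47 := fun x y hxy => by
    refine (norm_add_le _ _).trans ?_
    simpa using hxy
  have hE : ∀ w ∈ E, ‖w‖ ≤ R + 3 := fun w hw => by linarith [hR w hw]
  have hb : z ∈ baseE E → ‖z‖ ≤ R + 50 := fun h => by linarith [norm_le_of_mem_baseE hR h]
  cases q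
  · linarith [hR z hz]
  · rcases hz with h | h | h
    · exact hb h
    · exact key 3 _ _ (by norm_num) (hI 1 2 (by norm_num)) (norm_le_of_mem_baseE hR h)
        (by push_cast; ring)
    · exact key 9 _ _ (by norm_num) (hI 4 17 (by norm_num)) (hE _ h) (by push_cast; ring)
  · rcases hz with h | h
    · exact hb h
    · exact key 3 _ _ (by norm_num) (hI 1 11 (by norm_num)) (hE _ h) (by push_cast; ring)
  · rcases hz with h | h | h
    · exact hb h
    · exact key 3 _ _ (by norm_num) (hI 1 2 (by norm_num)) (norm_le_of_mem_baseE hR h)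
        (by push_cast; ring)
    · exact key 9 _ _ (by norm_num) (hI 4 (-1) (by norm_num)) (hE _ h) (by push_cast; ring)
  · rcases hz with h | h | h
    · exact hb h
    · exact key 3 _ _ (by norm_num) (hI 1 (-7) (by norm_num)) (norm_le_of_mem_baseE hR h)
        (by push_cast; ring)
    · exact key 9 _ _ (by norm_num) (hI 4 (-10) (by norm_num)) (hE _ h) (by push_cast; ring)

/-- The five shape sets solve the same graph-directed system as the tiles, and the solution is
unique. -/
theorem eq_tile_E (hE : IsFractalSquare 3 digitsE E) : E = transducerE.tile whole := by
  obtain ⟨R, hR⟩ := hE.isAttractor.isCompact.isBounded.exists_norm_le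
  obtain ⟨z₀, hz₀⟩ := hE.isAttractor.nonempty
  have hbase : ∃ w, w ∈ baseE E := ⟨z₀ / 3, Or.inl (mem_of_eq hz₀ (by ring))⟩
  obtain ⟨w, hw⟩ := hbase
  change shapeSet E whole = _
  apply subset_antisymm
  · refine DigitTransducer.subset_tile transducerE.norm_digit_le (S := shapeSet E) (R := R + 50)
      (fun q z hz => norm_le_of_mem_shapeSet hR q hz) (fun q z hz => ?_) whole
    obtain ⟨t, ht⟩ := exists_shapeSet_of_mem hE q hz
    exact ⟨t, _, ht, by ring⟩
  · exact DigitTransducer.tile_subset transducerE.norm_digit_le (S := shapeSet E) (R := ‖w‖)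
      (fun q => ⟨w, baseE_subset_shapeSet hE q hw, le_rfl⟩)
      (isClosed_shapeSet hE.isAttractor.isCompact.isClosed)
      (fun q t w hw => shapeSet_of_mem_next hE q t hw (by ring)) whole

end ShapesOfE

/-! ### Digit counts, dimension and conclusion. -/

theorem ncard_digitsE : digitsE.ncard = 5 := by
  have h : digitsE = ({0, 1, 2, 2 + Complex.I, 1 + 2 * Complex.I} : Finset ℂ) := by
    simp [digitsE]
  rw [h, ncard_coe_finset]
  repeat rw [Finset.card_insert_of_notMem (by simp [Complex.ext_iff])]
  simp

theorem ncard_digitsF : digitsF.ncard = 5 := by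
  have h : digitsF = ({1 + 2 * Complex.I, 1 + Complex.I, 1, 0, 2 + Complex.I} : Finset ℂ) := by
    simp [digitsF]
  rw [h, ncard_coe_finset]
  repeat rw [Finset.card_insert_of_notMem (by simp [Complex.ext_iff])]
  simp

theorem dimH_eq_ofReal {K : Set ℂ} {s : ℝ} (hs : 0 ≤ s) (h0 : 0 < μH[s] K) (h1 : μH[s] K < ∞) :
    dimH K = ENNReal.ofReal s := by
  lift s to ℝ≥0 using hs
  rw [ENNReal.ofReal_coe_nnreal]
  exact dimH_of_hausdorffMeasure_ne_zero_ne_top h0.ne' h1.ne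

theorem theorem1p2 (E F : Set ℂ) (hE : IsFractalSquare 3 digitsE E)
    (hF : IsFractalSquare 3 digitsF F) (s : ℝ) (hs : s = Real.log 5 / Real.log 3) :
    -- both sets belong to the class, and neither is connected or totally disconnected
    (E ∈ fractalSquareClass 3 5 ∧ F ∈ fractalSquareClass 3 5) ∧
    (¬ IsConnected E ∧ ¬ IsTotallyDisconnected E) ∧
    (¬ IsConnected F ∧ ¬ IsTotallyDisconnected F) ∧
    -- `s` is the Hausdorff dimension, and the `s`-dimensional measures are positive and finite
    dimH E = ENNReal.ofReal s ∧ dimH F = ENNReal.ofReal s ∧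
    (0 < μH[s] E ∧ μH[s] E < ∞) ∧ (0 < μH[s] F ∧ μH[s] F < ∞) ∧
    -- a measure-preserving bi-Lipschitz bijection; the product form also covers null sets
    ∃ f : ℂ → ℂ, IsBiLipschitzOn f E F ∧
      ∀ B : Set ℂ, MeasurableSet B → B ⊆ E →
        μH[s] B = μH[s] E / μH[s] F * μH[s] (f '' B) ∧
        (μH[s] B ≠ 0 → μH[s] B / μH[s] (f '' B) = μH[s] E / μH[s] F) := by
  have hclass : E ∈ fractalSquareClass 3 5 ∧ F ∈ fractalSquareClass 3 5 :=
    ⟨⟨digitsE, ncard_digitsE, hE⟩, ⟨digitsF, ncard_digitsF, hF⟩⟩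
  have hs0 : 0 < s := by
    rw [hs]
    exact div_pos (Real.log_pos (by norm_num)) (Real.log_pos (by norm_num))
  have hs3 : (3 : ℝ) ^ s = 5 := by
    rw [hs, Real.log_div_log, Real.rpow_logb (by norm_num) (by norm_num) (by norm_num)]
  have hEt := eq_tile_E hE
  have hFt := eq_image_tile_F hF
  have hcE := transducerE.isChain.isCoding .whole
  have huE := transducerE.isChain.isUniform hs0 hs3 .whole
  have hcF := (transducerF.isChain.isCoding ()).isometry_comp isometry_motionF
  have huF := (transducerF.isChain.isUniform hs0 hs3 ()).isometry_comp hs0 isometry_motionF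
  have hdE := transducerE.isChain.not_isTotallyDisconnected_image_tile .whole isometry_id
  have hdF := transducerF.isChain.not_isTotallyDisconnected_image_tile () isometry_motionF
  rw [image_id, ← hEt] at hdE
  rw [← hFt] at hdF
  have hEr : range (transducerE.point .whole) = E := hEt.symm
  have hFr : range (fun x => motionF (transducerF.point () x)) = F := by
    rw [hFt]
    exact range_comp motionF (transducerF.point ())
  set Ψ := transducerE.point .whole
  set Ψ' := fun x => motionF (transducerF.point () x)
  have hE0 := hcE.hausdorffMeasure_range_pos hs0 hs3
  have hE1 := hcE.hausdorffMeasure_range_lt_top hs0 hs3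
  have hF0 := hcF.hausdorffMeasure_range_pos hs0 hs3
  have hF1 := hcF.hausdorffMeasure_range_lt_top hs0 hs3
  have hbl := hcE.isBiLipschitzOn_recode hcF
  have hmeas : ∀ B : Set ℂ, MeasurableSet B → B ⊆ range Ψ → _ := fun B hB hBE =>
    hcE.measure_recode_mul hcF huE huF hE1.ne hF1.ne hB hBE
  have hnE := hcE.not_isConnected_range
  have hnF := hcF.not_isConnected_range
  rw [hEr] at hE0 hE1 hbl hmeas hnE
  rw [hFr] at hF0 hF1 hbl hmeas hnF
  refine ⟨hclass, ⟨hnE, hdE⟩, ⟨hnF, hdF⟩, dimH_eq_ofReal hs0.le hE0 hE1,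
    dimH_eq_ofReal hs0.le hF0 hF1, ⟨hE0, hE1⟩, ⟨hF0, hF1⟩, IsCoding.recode Ψ Ψ', hbl,
    fun B hB hBE => ?_⟩
  have h1 := hmeas B hB hBE
  have h2 : μH[s] B = μH[s] E / μH[s] F * μH[s] (IsCoding.recode Ψ Ψ' '' B) := by
    rw [div_eq_mul_inv, mul_right_comm, ← h1, mul_comm (μH[s] F), mul_assoc,
      ENNReal.mul_inv_cancel hF0.ne' hF1.ne, mul_one]
  refine ⟨h2, fun h0 => ?_⟩
  have h3 : μH[s] (IsCoding.recode Ψ Ψ' '' B) ≠ 0 := fun h => h0 (by rw [h2, h, mul_zero])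
  have h4 : μH[s] (IsCoding.recode Ψ Ψ' '' B) ≠ ∞ :=
    ((measure_mono ((image_mono hBE).trans hbl.1.image_eq.subset)).trans_lt hF1).ne
  conv_lhs => rw [h2]
  rw [mul_div_assoc, ENNReal.div_self h3 h4, mul_one]
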